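/- Let $\mathrm{Int}(\mathbb Z)\subset\mathbb Q[x]$ be the ring of polynomials $p$ with $p(\mathbb Z)\subset\mathbb Z$, with the Hopf algebra structure for which $x$ is primitive ($x\mapsto x\otimes 1+1\otimes x$), and with the decreasing, multiplicative degree filtration $\mathrm{fil}^i_{\deg}=\{p\in\mathrm{Int}(\mathbb Z):\deg p\le -i\}$, $i\in\mathbb Z$. Let $\mathrm{Rees}(\mathrm{fil}_{\deg})=\bigoplus_{i\in\mathbb Z}\mathrm{fil}^i_{\deg}\,t^{-i}$ be its Rees algebra, a graded commutative Hopf algebra over the graded ring $\mathbb Z[t]$, where $t$ has weight $1$. Let $\mathbb A^1/\mathbb G_m$ be the fpqc quotient stack over commutative rings: its points over $\operatorname{Spec}A$ are the $\mathbb G_m$-torsors $P\to\operatorname{Spec}A$ with a $\mathbb G_m$-equivariant map $P\to\mathbb A^1$. Let $\mathbb H_{\mathrm{fil}}=\mathrm{fSpec}(\mathrm{fil}_{\deg}\mathrm{Int}(\mathbb Z))\to\mathbb A^1/\mathbb G_m$ be the relative spectrum of the graded $\mathbb Z[t]$-algebra $\mathrm{Rees}(\mathrm{fil}_{\deg})$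 (its points over $(P,P\to\mathbb A^1)$ are the graded $\mathbb Z[t]$-algebra maps $\mathrm{Rees}(\mathrm{fil}_{\deg})\to\mathcal O(P)$), a commutative group over $\mathbb A^1/\mathbb G_m$ through the Hopf algebra structure. Let $\mathbb W$ be the ring scheme of big Witt vectors, with Frobenius maps $\mathrm{Frob}_n$ ($n\ge1$) and Teichmüller map $[-]$. Let $\mathbb H^t\subset\mathbb W\times\mathbb A^1$ be the subfunctor of pairs $(f,a)$ with $$\mathrm{Frob}_n(f)=[a]^{n-1}f\quad\text{for all } n\ge 1 .$$ It is a commutative group over $\mathbb A^1$ under Witt vector addition in $f$, and $\mathbb G_m$ acts on it compatibly by $u\cdot(f,a)=([u]f,ua)$, so that the quotient stack $\mathbb H^t/\mathbb G_m$ is a commutative group over $\mathbb A^1/\mathbb G_m$. Then there is an isomorphism of commutative groups over $\mathbb A^1/\mathbb G_m$ $$\mathbb H_{\mathrm{fil}}\;\cong\;\mathbb H^t/\mathbb G_m .$$ -/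

import Mathlib

universe u v

/-- Big Witt vectors: the underlying set of `𝕎(A)` is `A^{1,2,3,…}` (Witt coordinates). -/
@[ext] structure BigWitt (A : Type u) where
  coeff : ℕ+ → A

namespace BigWitt

/-- The `n`-th ghost component `w_n(x) = ∑_{d ∣ n} d · x_d ^ (n / d)`. -/
def ghost {A : Type u} [CommRing A] (n : ℕ+) (x : BigWitt A) : A :=
  ∑ d ∈ (n : ℕ).divisors, (d : A) * x.coeff d.toPNat' ^ ((n : ℕ) / d)

/-- Functoriality, coordinate by coordinate. -/
def mapFun {A : Type u} {B : Type v} (f : A → B) (x : BigWitt A) : BigWitt B :=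
  ⟨fun n => f (x.coeff n)⟩

theorem ghost_mapFun {A : Type u} {B : Type v} [CommRing A] [CommRing B] (f : A →+* B) (n : ℕ+)
    (x : BigWitt A) : ghost n (mapFun f x) = f (ghost n x) := by
  simp [ghost, mapFun, map_sum]

theorem ghost_eq {A : Type u} [CommRing A] (n : ℕ+) (x : BigWitt A) :
    ghost n x = (n : A) * x.coeff n +
      ∑ d ∈ (n : ℕ).properDivisors, (d : A) * x.coeff d.toPNat' ^ ((n : ℕ) / d) := by
  have h : (n : ℕ) ≠ 0 := n.ne_zero
  rw [ghost, ← Nat.insert_self_properDivisors h, Finset.sum_insert (by simp)]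
  simp [Nat.div_self n.pos]

theorem ghost_congr {A : Type u} [CommRing A] (n : ℕ+) (x y : BigWitt A)
    (h : ∀ m ≤ n, x.coeff m = y.coeff m) : ghost n x = ghost n y := by
  refine Finset.sum_congr rfl fun d hd => ?_
  have hd0 : 0 < d := Nat.pos_of_mem_divisors hd
  rw [h d.toPNat']
  rw [← PNat.coe_le_coe, Nat.toPNat'_coe, if_pos hd0]
  exact Nat.divisor_le hd

theorem ghost_injective {A : Type u} [CommRing A] (hA : ∀ (n : ℕ) (a : A), n ≠ 0 → (n : A) * a = 0 → a = 0)
    (x y : BigWitt A) (h : ∀ n, ghost n x = ghost n y) : x = y := by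
  ext n
  induction n using PNat.strongInductionOn with
  | _ n ih =>
    have h1 := h n
    rw [ghost_eq, ghost_eq, Finset.sum_congr rfl (g := fun d : ℕ => (d : A) * y.coeff d.toPNat' ^ ((n : ℕ) / d)),
      add_left_inj, ← sub_eq_zero, ← mul_sub] at h1
    · exact sub_eq_zero.mp (hA n _ n.ne_zero h1)
    · intro d hd
      rw [ih]
      have := Nat.mem_properDivisors.mp hd
      have hd0 : 0 < d := Nat.pos_of_mem_properDivisors hd
      rw [← PNat.coe_lt_coe, Nat.toPNat'_coe, if_pos hd0]
      exact this.2

section Dwork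

variable {σ : Type u}

theorem expand_sub_pow_dvd (p : ℕ) (hp : p.Prime) (f : MvPolynomial σ ℤ) :
    (p : MvPolynomial σ ℤ) ∣ f ^ p - MvPolynomial.expand p f := by
  have := Fact.mk hp
  have : (p : MvPolynomial σ ℤ) = MvPolynomial.C (p : ℤ) := by simp
  rw [this, MvPolynomial.C_dvd_iff_zmod, map_sub, map_pow, MvPolynomial.map_expand,
    MvPolynomial.expand_zmod, sub_self]

theorem pow_dvd_of_dvd_of_not_dvd {p d n : ℕ} (hp : p.Prime) (hn : n ≠ 0) (h1 : d ∣ p * n)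
    (h2 : ¬ d ∣ n) : p ^ (padicValNat p n + 1) ∣ d := by
  have hd : d ≠ 0 := by
    rintro rfl
    exact (mul_ne_zero hp.ne_zero hn) (zero_dvd_iff.mp h1)
  rw [← Nat.factorization_le_iff_dvd hd hn, Finsupp.le_def, not_forall] at h2
  obtain ⟨q, hq⟩ := h2
  push Not at hq
  have h3 := (Nat.factorization_le_iff_dvd hd (mul_ne_zero hp.ne_zero hn)).mpr h1 q
  rw [Nat.factorization_mul hp.ne_zero hn, hp.factorization, Finsupp.add_apply] at h3
  have hqp : p = q := by
    by_contra hne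
    rw [Finsupp.single_apply, if_neg hne] at h3
    omega
  subst hqp
  have : padicValNat p n = n.factorization p := (Nat.factorization_def n hp).symm
  rw [this]
  exact (pow_dvd_pow p hq).trans (Nat.ordProj_dvd d p)

/-- Sequences satisfying Dwork's congruences with respect to the Frobenius lifts `X_i ↦ X_i ^ p`. -/
def dwork (σ : Type u) : Subring (ℕ+ → MvPolynomial σ ℤ) where
  carrier := {w | ∀ p : ℕ, p.Prime → ∀ n m : ℕ+, (m : ℕ) = p * n →
    (p : MvPolynomial σ ℤ) ^ (padicValNat p n + 1) ∣ w m - MvPolynomial.expand p (w n)}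
  zero_mem' := by intro p hp n m h; simp
  one_mem' := by intro p hp n m h; simp
  add_mem' := by
    intro a b ha hb p hp n m h
    have := dvd_add (ha p hp n m h) (hb p hp n m h)
    simp only [Pi.add_apply, map_add]
    convert this using 1; ring
  neg_mem' := by
    intro a ha p hp n m h
    have := (ha p hp n m h).neg_right
    simp only [Pi.neg_apply, map_neg]
    convert this using 1; ring
  mul_mem' := by
    intro a b ha hb p hp n m h
    have := dvd_add ((hb p hp n m h).mul_left (a m))
      ((ha p hp n m h).mul_right (MvPolynomial.expand p (b n)))
    simp only [Pi.mul_apply, map_mul]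
    convert this using 1; ring

theorem ghost_mem_dwork (x : BigWitt (MvPolynomial σ ℤ)) : (fun n => ghost n x) ∈ dwork σ := by
  intro p hp n N hN
  have := Fact.mk hp
  have hn : (n : ℕ) ≠ 0 := n.ne_zero
  have hsub : (n : ℕ).divisors ⊆ (p * (n : ℕ)).divisors :=
    Nat.divisors_subset_of_dvd (mul_ne_zero hp.ne_zero hn) (dvd_mul_left _ _)
  simp only [ghost, hN, map_sum, map_mul, map_natCast, map_pow]
  rw [← Finset.sum_sdiff hsub, add_sub_assoc, ← Finset.sum_sub_distrib]
  refine dvd_add (Finset.dvd_sum fun d hd => ?_) (Finset.dvd_sum fun d hd => ?_)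
  · simp only [Finset.mem_sdiff, Nat.mem_divisors, not_and] at hd
    have h := pow_dvd_of_dvd_of_not_dvd hp hn hd.1.1 (fun h => hd.2 h hn)
    have h' := Nat.cast_dvd_cast (α := MvPolynomial σ ℤ) h
    rw [Nat.cast_pow] at h'
    exact h'.mul_right _
  · obtain ⟨m, hm⟩ := (Nat.mem_divisors.mp hd).1
    have hd0 : d ≠ 0 := by rintro rfl; simp at hm
    have hm0 : m ≠ 0 := by rintro rfl; simp at hm
    have e1 : p * (n : ℕ) / d = p * m := by
      rw [hm, mul_left_comm]; exact Nat.mul_div_cancel_left _ (Nat.pos_of_ne_zero hd0)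
    have e2 : (n : ℕ) / d = m := by
      rw [hm]; exact Nat.mul_div_cancel_left _ (Nat.pos_of_ne_zero hd0)
    rw [e1, e2, ← mul_sub, hm, padicValNat.mul hd0 hm0, add_assoc, pow_add, pow_mul]
    refine mul_dvd_mul ?_ ?_
    · exact_mod_cast Nat.cast_dvd_cast (α := MvPolynomial σ ℤ) (pow_padicValNat_dvd (p := p) (n := d))
    · obtain ⟨k, hk⟩ := pow_padicValNat_dvd (p := p) (n := m)
      have h1 := dvd_sub_pow_of_dvd_sub (expand_sub_pow_dvd p hp (x.coeff d.toPNat'))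
        (padicValNat p m)
      refine h1.trans ?_
      conv_rhs => rw [hk, pow_mul, pow_mul]
      exact sub_dvd_pow_sub_pow _ _ _

theorem natCast_dvd_of_prime_pow (n : ℕ) (f : MvPolynomial σ ℤ)
    (h : ∀ p k : ℕ, p.Prime → p ^ k ∣ n → ((p ^ k : ℕ) : MvPolynomial σ ℤ) ∣ f) :
    (n : MvPolynomial σ ℤ) ∣ f := by
  have key : ∀ m : ℕ, (m : MvPolynomial σ ℤ) ∣ f ↔ ∀ i, m ∣ (f.coeff i).natAbs := by
    intro m
    have : (m : MvPolynomial σ ℤ) = MvPolynomial.C (m : ℤ) := by simp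
    rw [this, MvPolynomial.C_dvd_iff_dvd_coeff]
    simp [Int.natCast_dvd]
  rw [key]
  intro i
  rw [Nat.dvd_iff_prime_pow_dvd_dvd]
  intro p k hp hk
  exact (key _).mp (h p k hp hk) i

open Classical in
/-- The Witt coordinates of a sequence of ghost components, computed recursively. -/
noncomputable def ofGhostCoeff (w : ℕ+ → MvPolynomial σ ℤ) (n : ℕ+) : MvPolynomial σ ℤ :=
  let a := w n - ∑ d ∈ (n : ℕ).properDivisors.attach,
    ((d : ℕ) : MvPolynomial σ ℤ) * ofGhostCoeff w (d : ℕ).toPNat' ^ ((n : ℕ) / d)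
  if h : (n : MvPolynomial σ ℤ) ∣ a then h.choose else 0
termination_by (n : ℕ)
decreasing_by
  rw [Nat.toPNat'_coe, if_pos (Nat.pos_of_mem_properDivisors d.2)]
  exact (Nat.mem_properDivisors.mp d.2).2

/-- The Witt vector with given ghost components (meaningful for sequences in `dwork σ`). -/
noncomputable def ofGhost (w : ℕ+ → MvPolynomial σ ℤ) : BigWitt (MvPolynomial σ ℤ) :=
  ⟨ofGhostCoeff w⟩

theorem ghost_ofGhost (w : ℕ+ → MvPolynomial σ ℤ) (hw : w ∈ dwork σ) (n : ℕ+) :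
    ghost n (ofGhost w) = w n := by
  induction n using PNat.strongInductionOn with
  | _ n ih =>
    set S : MvPolynomial σ ℤ := ∑ d ∈ (n : ℕ).properDivisors,
      (d : MvPolynomial σ ℤ) * (ofGhost w).coeff d.toPNat' ^ ((n : ℕ) / d) with hS
    have hS' : ∑ d ∈ (n : ℕ).properDivisors.attach, ((d : ℕ) : MvPolynomial σ ℤ) *
        ofGhostCoeff w (d : ℕ).toPNat' ^ ((n : ℕ) / d) = S := by
      exact Finset.sum_attach (n : ℕ).properDivisors fun d : ℕ =>
        (d : MvPolynomial σ ℤ) * ofGhostCoeff w d.toPNat' ^ ((n : ℕ) / d)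
    have hdvd : (n : MvPolynomial σ ℤ) ∣ w n - S := by
      refine natCast_dvd_of_prime_pow n _ fun p k hp hk => ?_
      rcases Nat.eq_zero_or_pos k with rfl | hk0
      · simp
      obtain ⟨m, hm⟩ := (dvd_pow_self p hk0.ne').trans hk
      have hm0 : 0 < m := Nat.pos_of_ne_zero (by rintro rfl; simp at hm)
      have := Fact.mk hp
      have hmc : (m.toPNat' : ℕ) = m := by rw [Nat.toPNat'_coe, if_pos hm0]
      have hn : (n : ℕ) = p * m.toPNat' := by rw [hmc, hm]
      have hmn : m.toPNat' < n := by
        rw [← PNat.coe_lt_coe, hmc, hm]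
        exact lt_mul_left hm0 hp.one_lt
      let y : BigWitt (MvPolynomial σ ℤ) :=
        ⟨fun i => if i < n then (ofGhost w).coeff i else 0⟩
      have hy1 : ghost n y = S := by
        rw [ghost_eq]
        simp only [y, lt_irrefl, if_false, mul_zero, zero_add]
        rw [hS]
        refine Finset.sum_congr rfl fun d hd => ?_
        rw [if_pos]
        rw [← PNat.coe_lt_coe, Nat.toPNat'_coe, if_pos (Nat.pos_of_mem_properDivisors hd)]
        exact (Nat.mem_properDivisors.mp hd).2
      have hy2 : ghost m.toPNat' y = w m.toPNat' := by
        rw [← ih _ hmn]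
        refine ghost_congr _ _ _ fun i hi => ?_
        simp only [y]
        rw [if_pos (lt_of_le_of_lt hi hmn)]
      have h1 := ghost_mem_dwork y p hp m.toPNat' n hn
      have h2 := hw p hp m.toPNat' n hn
      simp only [hy1, hy2, hmc] at h1 h2
      have h3 := dvd_sub h2 h1
      rw [sub_sub_sub_cancel_right] at h3
      refine dvd_trans ?_ h3
      rw [Nat.cast_pow]
      refine pow_dvd_pow _ ?_
      have hk' : k ≤ padicValNat p n := (padicValNat_dvd_iff_le n.ne_zero).mp hk
      rw [hm, padicValNat.mul hp.ne_zero hm0.ne', padicValNat_self] at hk'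
      simpa [add_comm] using hk'
    have hc : (n : MvPolynomial σ ℤ) * (ofGhost w).coeff n = w n - S := by
      change (n : MvPolynomial σ ℤ) * ofGhostCoeff w n = _
      rw [ofGhostCoeff]
      have hdvd' := hdvd
      rw [← hS'] at hdvd'
      rw [dif_pos hdvd', ← hS']
      exact hdvd'.choose_spec.symm
    rw [ghost_eq, hc]
    ring

end Dwork

section Ops

variable {ι : Type} {A : Type u} {B : Type v} [CommRing A] [CommRing B]

/-- The generic Witt vectors `X_i`, `i : ι`. -/
noncomputable def generic (i : ι) : BigWitt (MvPolynomial (ι × ℕ+) ℤ) :=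
  ⟨fun n => MvPolynomial.X (i, n)⟩

/-- Evaluation of polynomials in Witt coordinates at a family of Witt vectors. -/
noncomputable def evalHom (v : ι → BigWitt A) : MvPolynomial (ι × ℕ+) ℤ →+* A :=
  MvPolynomial.eval₂Hom (Int.castRingHom A) fun q => (v q.1).coeff q.2

/-- The natural operation on Witt vectors given by a universal sequence of ghost components. -/
noncomputable def op (w : ℕ+ → MvPolynomial (ι × ℕ+) ℤ) (v : ι → BigWitt A) : BigWitt A :=
  mapFun (evalHom v) (ofGhost w)

theorem ghost_op (w : ℕ+ → MvPolynomial (ι × ℕ+) ℤ) (hw : w ∈ dwork _) (v : ι → BigWitt A)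
    (n : ℕ+) : ghost n (op w v) = evalHom v (w n) := by
  rw [op, ghost_mapFun, ghost_ofGhost w hw]

theorem evalHom_ghost (v : ι → BigWitt A) (n : ℕ+) (i : ι) :
    evalHom v (ghost n (generic i)) = ghost n (v i) := by
  rw [← ghost_mapFun]
  congr 1
  ext m
  simp [mapFun, generic, evalHom]

theorem mapFun_op (f : A →+* B) (w : ℕ+ → MvPolynomial (ι × ℕ+) ℤ) (v : ι → BigWitt A) :
    mapFun f (op w v) = op w (fun i => mapFun f (v i)) := by
  have : f.comp (evalHom v) = evalHom (fun i => mapFun f (v i)) := by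
    refine MvPolynomial.ringHom_ext (fun r => by simp) fun q => ?_
    simp [evalHom, mapFun]
  ext n
  exact RingHom.congr_fun this _

/-- The Teichmüller representative `[a] = (a, 0, 0, …)`. -/
def teichFun (a : A) : BigWitt A := ⟨fun n => if n = 1 then a else 0⟩

theorem ghost_teichFun (a : A) (n : ℕ+) : ghost n (teichFun a) = a ^ (n : ℕ) := by
  rw [ghost, Finset.sum_eq_single 1]
  · simp [teichFun, show Nat.toPNat' 1 = 1 from rfl]
  · intro d hd hd1
    have hd0 := Nat.pos_of_mem_divisors hd
    have : d.toPNat' ≠ 1 := by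
      intro h
      have := congrArg PNat.val h
      rw [Nat.toPNat'_coe, if_pos hd0] at this
      exact hd1 this
    have h2 : (n : ℕ) / d ≠ 0 :=
      (Nat.div_pos (Nat.divisor_le hd) hd0).ne'
    simp [teichFun, this, h2]
  · simp

noncomputable instance : Zero (BigWitt A) := ⟨teichFun 0⟩
noncomputable instance : One (BigWitt A) := ⟨teichFun 1⟩
noncomputable instance : Add (BigWitt A) :=
  ⟨fun x y => op (ι := Fin 2) (fun n => ghost n (generic 0) + ghost n (generic 1)) ![x, y]⟩
noncomputable instance : Mul (BigWitt A) :=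
  ⟨fun x y => op (ι := Fin 2) (fun n => ghost n (generic 0) * ghost n (generic 1)) ![x, y]⟩
noncomputable instance : Neg (BigWitt A) :=
  ⟨fun x => op (ι := Fin 1) (fun n => -ghost n (generic 0)) ![x]⟩

/-- The Frobenius `Frob_m`, determined by `w_n (Frob_m x) = w_{m n} x`. -/
noncomputable def frobFun (m : ℕ+) (x : BigWitt A) : BigWitt A :=
  op (ι := Fin 1) (fun n => ghost (m * n) (generic 0)) ![x]

@[simp] theorem ghost_zero (n : ℕ+) : ghost n (0 : BigWitt A) = 0 := by
  change ghost n (teichFun 0) = 0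
  rw [ghost_teichFun, zero_pow n.ne_zero]

@[simp] theorem ghost_one (n : ℕ+) : ghost n (1 : BigWitt A) = 1 := by
  change ghost n (teichFun 1) = 1
  rw [ghost_teichFun, one_pow]

@[simp] theorem ghost_add (n : ℕ+) (x y : BigWitt A) : ghost n (x + y) = ghost n x + ghost n y := by
  change ghost n (op _ _) = _
  rw [ghost_op _ (show (fun n => ghost n (generic (0 : Fin 2)) + ghost n (generic 1)) ∈ dwork _ from
    (dwork _).add_mem (ghost_mem_dwork _) (ghost_mem_dwork _))]
  simp [evalHom_ghost]

@[simp] theorem ghost_mul (n : ℕ+) (x y : BigWitt A) : ghost n (x * y) = ghost n x * ghost n y := by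
  change ghost n (op _ _) = _
  rw [ghost_op _ (show (fun n => ghost n (generic (0 : Fin 2)) * ghost n (generic 1)) ∈ dwork _ from
    (dwork _).mul_mem (ghost_mem_dwork _) (ghost_mem_dwork _))]
  simp [evalHom_ghost]

@[simp] theorem ghost_neg (n : ℕ+) (x : BigWitt A) : ghost n (-x) = -ghost n x := by
  change ghost n (op _ _) = _
  rw [ghost_op _ (show (fun n => -ghost n (generic (0 : Fin 1))) ∈ dwork _ from
    (dwork _).neg_mem (ghost_mem_dwork _))]
  simp [evalHom_ghost]

@[simp] theorem ghost_frobFun (n m : ℕ+) (x : BigWitt A) :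
    ghost n (frobFun m x) = ghost (m * n) x := by
  have h : (fun n => ghost (m * n) (generic (0 : Fin 1))) ∈ dwork (Fin 1 × ℕ+) := by
    intro p hp n N hN
    have := Fact.mk hp
    have := ghost_mem_dwork (generic (0 : Fin 1)) p hp (m * n) (m * N) (by
      rw [PNat.mul_coe, PNat.mul_coe, hN, mul_left_comm])
    refine dvd_trans (pow_dvd_pow _ ?_) this
    rw [PNat.mul_coe, padicValNat.mul m.ne_zero n.ne_zero]
    omega
  rw [frobFun, ghost_op _ h]
  simp [evalHom_ghost]

theorem mapFun_teichFun (f : A →+* B) (a : A) : mapFun f (teichFun a) = teichFun (f a) := by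
  ext n; simp [mapFun, teichFun, apply_ite f]

theorem mapFun_zero (f : A →+* B) : mapFun f (0 : BigWitt A) = 0 := by
  change mapFun f (teichFun 0) = teichFun 0
  rw [mapFun_teichFun, map_zero]

theorem mapFun_one (f : A →+* B) : mapFun f (1 : BigWitt A) = 1 := by
  change mapFun f (teichFun 1) = teichFun 1
  rw [mapFun_teichFun, map_one]

theorem mapFun_add (f : A →+* B) (x y : BigWitt A) :
    mapFun f (x + y) = mapFun f x + mapFun f y := by
  change mapFun f (op _ _) = op _ _
  rw [mapFun_op]; congr 1; ext i : 1; fin_cases i <;> rfl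

theorem mapFun_mul (f : A →+* B) (x y : BigWitt A) :
    mapFun f (x * y) = mapFun f x * mapFun f y := by
  change mapFun f (op _ _) = op _ _
  rw [mapFun_op]; congr 1; ext i : 1; fin_cases i <;> rfl

theorem mapFun_neg (f : A →+* B) (x : BigWitt A) : mapFun f (-x) = -mapFun f x := by
  change mapFun f (op _ _) = op _ _
  rw [mapFun_op]; congr 1; ext i : 1; fin_cases i; rfl

theorem mapFun_frobFun (f : A →+* B) (m : ℕ+) (x : BigWitt A) :
    mapFun f (frobFun m x) = frobFun m (mapFun f x) := by
  change mapFun f (op _ _) = op _ _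
  rw [mapFun_op]; congr 1; ext i : 1; fin_cases i; rfl

/-- Every Witt vector lifts to the polynomial ring `ℤ[A]`. -/
theorem exists_lift (x : BigWitt A) : ∃ y : BigWitt (MvPolynomial A ℤ),
    mapFun (MvPolynomial.eval₂Hom (Int.castRingHom A) id) y = x :=
  ⟨⟨fun n => MvPolynomial.X (x.coeff n)⟩, by ext n; simp [mapFun]⟩

theorem ghost_injective_mvPolynomial {σ : Type u} (x y : BigWitt (MvPolynomial σ ℤ))
    (h : ∀ n, ghost n x = ghost n y) : x = y :=
  ghost_injective (fun _ _ hn ha => (mul_eq_zero.mp ha).resolve_left (Nat.cast_ne_zero.mpr hn)) x y h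

/-- The big Witt vector ring; the operations are those for which all ghost components are
natural ring homomorphisms. -/
noncomputable instance : CommRing (BigWitt A) where
  add_assoc x y z := by
    obtain ⟨x, rfl⟩ := exists_lift x
    obtain ⟨y, rfl⟩ := exists_lift y
    obtain ⟨z, rfl⟩ := exists_lift z
    simp only [← mapFun_add]
    exact congrArg _ (ghost_injective_mvPolynomial _ _ fun n => by simp only [ghost_add]; ring)
  zero_add x := by
    obtain ⟨x, rfl⟩ := exists_lift x
    rw [← mapFun_zero (MvPolynomial.eval₂Hom (Int.castRingHom A) id), ← mapFun_add]
    exact congrArg _ (ghost_injective_mvPolynomial _ _ fun n => by simp)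
  add_zero x := by
    obtain ⟨x, rfl⟩ := exists_lift x
    rw [← mapFun_zero (MvPolynomial.eval₂Hom (Int.castRingHom A) id), ← mapFun_add]
    exact congrArg _ (ghost_injective_mvPolynomial _ _ fun n => by simp)
  add_comm x y := by
    obtain ⟨x, rfl⟩ := exists_lift x
    obtain ⟨y, rfl⟩ := exists_lift y
    simp only [← mapFun_add]
    exact congrArg _ (ghost_injective_mvPolynomial _ _ fun n => by simp only [ghost_add]; ring)
  neg_add_cancel x := by
    obtain ⟨x, rfl⟩ := exists_lift x
    rw [← mapFun_zero (MvPolynomial.eval₂Hom (Int.castRingHom A) id), ← mapFun_neg, ← mapFun_add]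
    exact congrArg _ (ghost_injective_mvPolynomial _ _ fun n => by simp)
  mul_assoc x y z := by
    obtain ⟨x, rfl⟩ := exists_lift x
    obtain ⟨y, rfl⟩ := exists_lift y
    obtain ⟨z, rfl⟩ := exists_lift z
    simp only [← mapFun_mul]
    exact congrArg _ (ghost_injective_mvPolynomial _ _ fun n => by simp only [ghost_mul]; ring)
  one_mul x := by
    obtain ⟨x, rfl⟩ := exists_lift x
    rw [← mapFun_one (MvPolynomial.eval₂Hom (Int.castRingHom A) id), ← mapFun_mul]
    exact congrArg _ (ghost_injective_mvPolynomial _ _ fun n => by simp)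
  mul_one x := by
    obtain ⟨x, rfl⟩ := exists_lift x
    rw [← mapFun_one (MvPolynomial.eval₂Hom (Int.castRingHom A) id), ← mapFun_mul]
    exact congrArg _ (ghost_injective_mvPolynomial _ _ fun n => by simp)
  zero_mul x := by
    obtain ⟨x, rfl⟩ := exists_lift x
    rw [← mapFun_zero (MvPolynomial.eval₂Hom (Int.castRingHom A) id), ← mapFun_mul]
    exact congrArg _ (ghost_injective_mvPolynomial _ _ fun n => by simp)
  mul_zero x := by
    obtain ⟨x, rfl⟩ := exists_lift x
    rw [← mapFun_zero (MvPolynomial.eval₂Hom (Int.castRingHom A) id), ← mapFun_mul]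
    exact congrArg _ (ghost_injective_mvPolynomial _ _ fun n => by simp)
  mul_comm x y := by
    obtain ⟨x, rfl⟩ := exists_lift x
    obtain ⟨y, rfl⟩ := exists_lift y
    simp only [← mapFun_mul]
    exact congrArg _ (ghost_injective_mvPolynomial _ _ fun n => by simp only [ghost_mul]; ring)
  left_distrib x y z := by
    obtain ⟨x, rfl⟩ := exists_lift x
    obtain ⟨y, rfl⟩ := exists_lift y
    obtain ⟨z, rfl⟩ := exists_lift z
    simp only [← mapFun_mul, ← mapFun_add]
    exact congrArg _ (ghost_injective_mvPolynomial _ _ fun n => by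
      simp only [ghost_mul, ghost_add]; ring)
  right_distrib x y z := by
    obtain ⟨x, rfl⟩ := exists_lift x
    obtain ⟨y, rfl⟩ := exists_lift y
    obtain ⟨z, rfl⟩ := exists_lift z
    simp only [← mapFun_mul, ← mapFun_add]
    exact congrArg _ (ghost_injective_mvPolynomial _ _ fun n => by
      simp only [ghost_mul, ghost_add]; ring)
  nsmul := nsmulRec
  zsmul := zsmulRec

/-- Functoriality `𝕎(A) → 𝕎(B)`. -/
noncomputable def map (f : A →+* B) : BigWitt A →+* BigWitt B where
  toFun := mapFun f
  map_zero' := mapFun_zero f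
  map_one' := mapFun_one f
  map_add' := mapFun_add f
  map_mul' := mapFun_mul f

/-- The Frobenius endomorphisms `Frob_m : 𝕎(A) → 𝕎(A)`. -/
noncomputable def frob (m : ℕ+) : BigWitt A →+* BigWitt A where
  toFun := frobFun m
  map_zero' := by
    rw [← mapFun_zero (Int.castRingHom A), ← mapFun_zero (MvPolynomial.eval₂Hom (Int.castRingHom ℤ) (fun i : Empty => i.elim)),
      ← mapFun_frobFun, ← mapFun_frobFun]
    exact congrArg _ (congrArg _ (ghost_injective_mvPolynomial _ _ fun n => by simp))
  map_one' := by
    rw [← mapFun_one (Int.castRingHom A), ← mapFun_one (MvPolynomial.eval₂Hom (Int.castRingHom ℤ) (fun i : Empty => i.elim)),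
      ← mapFun_frobFun, ← mapFun_frobFun]
    exact congrArg _ (congrArg _ (ghost_injective_mvPolynomial _ _ fun n => by simp))
  map_add' x y := by
    obtain ⟨x, rfl⟩ := exists_lift x
    obtain ⟨y, rfl⟩ := exists_lift y
    simp only [← mapFun_add, ← mapFun_frobFun]
    exact congrArg _ (ghost_injective_mvPolynomial _ _ fun n => by simp)
  map_mul' x y := by
    obtain ⟨x, rfl⟩ := exists_lift x
    obtain ⟨y, rfl⟩ := exists_lift y
    simp only [← mapFun_mul, ← mapFun_frobFun]
    exact congrArg _ (ghost_injective_mvPolynomial _ _ fun n => by simp)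

theorem map_frob (f : A →+* B) (m : ℕ+) (x : BigWitt A) :
    map f (frob m x) = frob m (map f x) := mapFun_frobFun f m x

/-- The Teichmüller map `[-] : A → 𝕎(A)`, `[a] = (a, 0, 0, …)`. -/
noncomputable def teich : A →* BigWitt A where
  toFun := teichFun
  map_one' := rfl
  map_mul' a b := by
    have h : (teichFun (MvPolynomial.X a * MvPolynomial.X b) : BigWitt (MvPolynomial A ℤ)) =
        teichFun (MvPolynomial.X a) * teichFun (MvPolynomial.X b) :=
      ghost_injective_mvPolynomial _ _ fun n => by
        simp only [ghost_mul, ghost_teichFun, mul_pow]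
    have := congrArg (mapFun (MvPolynomial.eval₂Hom (Int.castRingHom A) id)) h
    rw [mapFun_mul, mapFun_teichFun, mapFun_teichFun, mapFun_teichFun] at this
    simpa using this

theorem map_teich (f : A →+* B) (a : A) : map f (teich a) = teich (f a) :=
  mapFun_teichFun f a

theorem frob_teich (m : ℕ+) (a : A) : frob m (teich a) = teich a ^ (m : ℕ) := by
  have h : (frobFun m (teichFun (MvPolynomial.X a)) : BigWitt (MvPolynomial A ℤ)) =
      teichFun (MvPolynomial.X a ^ (m : ℕ)) :=
    ghost_injective_mvPolynomial _ _ fun n => by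
      simp only [ghost_frobFun, ghost_teichFun, PNat.mul_coe, pow_mul]
  have := congrArg (mapFun (MvPolynomial.eval₂Hom (Int.castRingHom A) id)) h
  rw [← map_pow]
  change frobFun m (teichFun a) = teichFun (a ^ (m : ℕ))
  rw [mapFun_frobFun, mapFun_teichFun, mapFun_teichFun] at this
  simpa using this

end Ops

end BigWitt

open Polynomial
open scoped TensorProduct LaurentPolynomial

/-- A decreasing, multiplicative, `ℤ`-indexed filtration on a commutative ring, i.e. a filtered
commutative ring `⋯ ⊆ F^{i+1} ⊆ F^i ⊆ F^{i-1} ⊆ ⋯`. -/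
structure RingFiltration (R : Type u) [CommRing R] where
  fil : ℤ → AddSubgroup R
  antitone : Antitone fil
  one_mem : 1 ∈ fil 0
  mul_mem : ∀ {i j : ℤ} {a b : R}, a ∈ fil i → b ∈ fil j → a * b ∈ fil (i + j)

namespace RingFiltration

variable {R : Type u} [CommRing R] (F : RingFiltration R)

/-- The Rees ring `⨁_i F^i · t^{-i} ⊆ R[t, t⁻¹]`. -/
def rees : Subring R[T;T⁻¹] where
  carrier := {f | ∀ n : ℤ, f.coeff n ∈ F.fil (-n)}
  zero_mem' n := by simp
  one_mem' n := by
    rw [AddMonoidAlgebra.one_def, AddMonoidAlgebra.coeff_single, Finsupp.single_apply]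
    split_ifs with h
    · subst h; simpa using F.one_mem
    · exact zero_mem _
  add_mem' {f g} hf hg n := by
    rw [AddMonoidAlgebra.coeff_add]; exact add_mem (hf n) (hg n)
  neg_mem' {f} hf n := by
    rw [AddMonoidAlgebra.coeff_neg]; exact neg_mem (hf n)
  mul_mem' {f g} hf hg n := by
    rw [AddMonoidAlgebra.mul_def, Finsupp.sum, AddMonoidAlgebra.coeff_sum, Finsupp.finsetSum_apply]
    refine sum_mem fun i _ => ?_
    rw [Finsupp.sum, AddMonoidAlgebra.coeff_sum, Finsupp.finsetSum_apply]
    refine sum_mem fun j _ => ?_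
    rw [AddMonoidAlgebra.coeff_single, Finsupp.single_apply]
    split_ifs with h
    · subst h
      rw [neg_add]
      exact F.mul_mem (hf i) (hg j)
    · exact zero_mem _

/-- The homogeneous element `a · t^n` of the Rees ring, for `a ∈ F^{-n}`. -/
noncomputable def hom (n : ℤ) (a : R) (ha : a ∈ F.fil (-n)) : F.rees :=
  ⟨.single n a, fun m => by
    rw [AddMonoidAlgebra.coeff_single, Finsupp.single_apply]
    split_ifs with h
    · subst h; exact ha
    · exact zero_mem _⟩

/-- The parameter `t` of the Rees ring, the element `1 ∈ F^{-1}` in weight `1`. -/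
noncomputable def t : F.rees := F.hom 1 1 (F.antitone (by norm_num) F.one_mem)

/-- The Rees ring as an algebra over `ℤ[t]`. -/
noncomputable instance : Algebra ℤ[X] F.rees := (Polynomial.aeval F.t).toRingHom.toAlgebra

theorem algebraMap_X : algebraMap ℤ[X] F.rees X = F.t := Polynomial.aeval_X _

end RingFiltration

/-- The ring `Int(ℤ)` of integer-valued polynomials. -/
def IntZ : Subring ℚ[X] where
  carrier := {f | ∀ k : ℤ, ∃ m : ℤ, f.eval (k : ℚ) = m}
  zero_mem' _ := ⟨0, by simp⟩
  one_mem' _ := ⟨1, by simp⟩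
  add_mem' hf hg k := by
    obtain ⟨a, ha⟩ := hf k
    obtain ⟨b, hb⟩ := hg k
    exact ⟨a + b, by simp [ha, hb]⟩
  neg_mem' hf k := by
    obtain ⟨a, ha⟩ := hf k
    exact ⟨-a, by simp [ha]⟩
  mul_mem' hf hg k := by
    obtain ⟨a, ha⟩ := hf k
    obtain ⟨b, hb⟩ := hg k
    exact ⟨a * b, by simp [ha, hb]⟩

namespace IntZ

/-- The degree filtration on `Int(ℤ)`, indexed as a decreasing filtration: `fil^i` consists of the
integer-valued polynomials of degree at most `-i`. -/
def filDeg : RingFiltration IntZ where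
  fil i :=
    { carrier := {f | ∀ k : ℕ, -i < (k : ℤ) → (f : ℚ[X]).coeff k = 0}
      zero_mem' := fun k _ => by simp
      add_mem' := fun {f g} hf hg k hk => by
        simp [hf k hk, hg k hk]
      neg_mem' := fun {f} hf k hk => by simp [hf k hk] }
  antitone i j hij f hf k hk := hf k (by omega)
  one_mem k hk := by
    have : k ≠ 0 := by omega
    simp [Polynomial.coeff_one, this]
  mul_mem {i j f g} hf hg k hk := by
    rw [Subring.coe_mul, Polynomial.coeff_mul]
    refine Finset.sum_eq_zero fun q hq => ?_
    have hq' := Finset.HasAntidiagonal.mem_antidiagonal.mp hq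
    by_cases h : -i < (q.1 : ℤ)
    · rw [hf _ h, zero_mul]
    · rw [hg _ (by omega), mul_zero]

theorem mem_filDeg {i : ℤ} {f : IntZ} :
    f ∈ filDeg.fil i ↔ ∀ k : ℕ, -i < (k : ℤ) → (f : ℚ[X]).coeff k = 0 := Iff.rfl

/-- Evaluation of integer-valued polynomials at an integer. -/
noncomputable def ev (k : ℤ) : IntZ →+* ℤ where
  toFun f := (f.2 k).choose
  map_zero' := Int.cast_injective (α := ℚ) (by rw [← ((0 : IntZ).2 k).choose_spec]; simp)
  map_one' := Int.cast_injective (α := ℚ) (by rw [← ((1 : IntZ).2 k).choose_spec]; simp)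
  map_add' f g := Int.cast_injective (α := ℚ) (by
    rw [← ((f + g).2 k).choose_spec, Int.cast_add, ← (f.2 k).choose_spec,
      ← (g.2 k).choose_spec]; simp)
  map_mul' f g := Int.cast_injective (α := ℚ) (by
    rw [← ((f * g).2 k).choose_spec, Int.cast_mul, ← (f.2 k).choose_spec,
      ← (g.2 k).choose_spec]; simp)

theorem coe_ev (k : ℤ) (f : IntZ) : ((ev k f : ℤ) : ℚ) = (f : ℚ[X]).eval (k : ℚ) :=
  (f.2 k).choose_spec.symm

theorem eval_descPochhammer (n : ℕ) (k : ℤ) : (descPochhammer ℚ n).eval (k : ℚ) =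
    n.factorial * (Ring.choose k n : ℤ) := by
  have h := Ring.descPochhammer_eq_factorial_smul_choose k n
  rw [← Polynomial.aeval_eq_smeval, Polynomial.coe_aeval_eq_eval] at h
  have h2 := congrArg (Int.cast : ℤ → ℚ) h
  rw [← descPochhammer_map (Int.castRingHom ℚ), Polynomial.eval_intCast_map]
  simpa using h2

/-- The Hilbert polynomials `x(x-1)⋯(x-n+1)/n!`. -/
noncomputable def binom (n : ℕ) : IntZ :=
  ⟨C ((n.factorial : ℚ)⁻¹) * descPochhammer ℚ n, fun k => ⟨Ring.choose k n, by
    rw [eval_mul, eval_C, eval_descPochhammer, inv_mul_cancel_left₀]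
    exact_mod_cast n.factorial_ne_zero⟩⟩

theorem ev_binom (n : ℕ) (k : ℤ) : ev k (binom n) = Ring.choose k n := by
  apply Int.cast_injective (α := ℚ)
  rw [coe_ev, binom, eval_mul, eval_C, eval_descPochhammer, inv_mul_cancel_left₀]
  exact_mod_cast n.factorial_ne_zero

theorem binom_mem (n : ℕ) : binom n ∈ filDeg.fil (-(n : ℤ)) := by
  intro k hk
  rw [binom, coeff_C_mul, coeff_eq_zero_of_natDegree_lt, mul_zero]
  rw [descPochhammer_natDegree]
  omega

theorem eq_sum_binom (f : IntZ) (n : ℕ) (hf : f ∈ filDeg.fil (-(n : ℤ))) :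
    ∃ c : ℕ → ℤ, f = ∑ i ∈ Finset.range (n + 1), c i • binom i := by
  let G : ℕ → ℤ := fun m => ev m f
  refine ⟨fun i => (fwdDiff 1)^[i] G 0, ?_⟩
  rw [← sub_eq_zero]
  set g : IntZ := f - ∑ i ∈ Finset.range (n + 1), (fwdDiff 1)^[i] G 0 • binom i with hg
  have hgm : g ∈ filDeg.fil (-(n : ℤ)) := by
    refine sub_mem hf (sum_mem fun i hi => zsmul_mem (filDeg.antitone ?_ (binom_mem i)) _)
    have := Finset.mem_range.mp hi
    omega
  have hev : ∀ j : ℕ, j ≤ n → ev j g = 0 := by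
    intro j hj
    have h := shift_eq_sum_fwdDiff_iter (1 : ℕ) G j 0
    simp only [zero_add, smul_eq_mul, mul_one] at h
    rw [hg, map_sub, map_sum, sub_eq_zero]
    change G j = _
    rw [h, Finset.sum_subset (Finset.range_mono (Nat.add_le_add_right hj 1))]
    · refine Finset.sum_congr rfl fun i _ => ?_
      rw [map_zsmul, ev_binom, Ring.choose_natCast]
      simp [mul_comm]
    · intro i _ hi
      have : j < i := by simpa using hi
      simp [Nat.choose_eq_zero_of_lt this]
  have : (g : ℚ[X]) = 0 := by
    refine eq_zero_of_natDegree_lt_card_of_eval_eq_zero' _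
      ((Finset.range (n + 1)).image (Nat.cast : ℕ → ℚ)) ?_ ?_
    · intro x hx
      obtain ⟨j, hj, rfl⟩ := Finset.mem_image.mp hx
      have := hev j (Nat.lt_succ_iff.mp (Finset.mem_range.mp hj))
      have h2 := coe_ev j g
      rw [this] at h2
      simpa using h2.symm
    · rw [Finset.card_image_of_injective _ Nat.cast_injective, Finset.card_range,
        Nat.lt_succ_iff, natDegree_le_iff_coeff_eq_zero]
      exact fun k hk => hgm k (by omega)
  exact Subtype.ext this

/-- The substitution `f(x) ↦ f(-x)`. -/
noncomputable def reflect : IntZ →+* IntZ where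
  toFun f := ⟨(f : ℚ[X]).comp (-X), fun k => by
    obtain ⟨m, hm⟩ := f.2 (-k)
    exact ⟨m, by simpa using hm⟩⟩
  map_zero' := Subtype.ext (by simp)
  map_one' := Subtype.ext (by simp)
  map_add' f g := Subtype.ext (by simp)
  map_mul' f g := Subtype.ext (by simp)

theorem ev_reflect (k : ℤ) (f : IntZ) : ev k (reflect f) = ev (-k) f := by
  apply Int.cast_injective (α := ℚ)
  rw [coe_ev, coe_ev]
  simp [reflect]

theorem reflect_mem {i : ℤ} {f : IntZ} (hf : f ∈ filDeg.fil i) : reflect f ∈ filDeg.fil i := by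
  intro k hk
  have : ((f : ℚ[X]).comp (-X)).coeff k = (-1) ^ k * (f : ℚ[X]).coeff k := by
    rw [show (-X : ℚ[X]) = C (-1) * X by simp, comp_C_mul_X_coeff, mul_comm]
  change ((f : ℚ[X]).comp (-X)).coeff k = 0
  rw [this, hf k hk, mul_zero]

end IntZ

/-- The Rees algebra of the degree filtration on `Int(ℤ)`, an algebra over `ℤ[t]`. -/
abbrev ReesIntZ : Type := IntZ.filDeg.rees

namespace ReesIntZ

open IntZ

theorem mapRingHom_single {R : Type u} {S : Type v} [CommRing R] [CommRing S] (f : R →+* S) (n : ℤ) (a : R) :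
    AddMonoidAlgebra.mapRingHom ℤ f (.single n a) = .single n (f a) := by
  refine LaurentPolynomial.ext fun m => ?_
  simp only [AddMonoidAlgebra.coeff_mapRingHom, AddMonoidAlgebra.coeff_single,
    Finsupp.single_apply, apply_ite f, map_zero]

/-- Specialisation `x ↦ k` of the Rees algebra. -/
noncomputable def ev (k : ℤ) : ReesIntZ →ₐ[ℤ[X]] ℤ[T;T⁻¹] :=
  { (AddMonoidAlgebra.mapRingHom ℤ (IntZ.ev k)).comp filDeg.rees.subtype with
    commutes' := fun p => by
      have : ((AddMonoidAlgebra.mapRingHom ℤ (IntZ.ev k)).comp filDeg.rees.subtype).comp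
          (algebraMap ℤ[X] ReesIntZ) = algebraMap ℤ[X] ℤ[T;T⁻¹] := by
        refine Polynomial.ringHom_ext (fun n => by simp) ?_
        rw [RingHom.comp_apply, RingFiltration.algebraMap_X, RingHom.comp_apply,
          LaurentPolynomial.algebraMap_eq_toLaurent, Polynomial.toLaurent_X]
        exact mapRingHom_single _ _ _ |>.trans (by rw [map_one]; rfl)
      exact RingHom.congr_fun this p }

theorem ev_hom (k n : ℤ) (f : IntZ) (hf : f ∈ filDeg.fil (-n)) :
    ev k (filDeg.hom n f hf) = .single n (IntZ.ev k f) := by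
  exact mapRingHom_single _ _ _

/-- The basis elements `x(x-1)⋯(x-n+1)/n! · t^n`. -/
noncomputable def b (n : ℕ) : ReesIntZ := filDeg.hom n (binom n) (binom_mem n)

theorem ev_b (k : ℤ) (n : ℕ) : ev k (b n) = .single (n : ℤ) (Ring.choose k n) := by
  rw [b, ev_hom, ev_binom]

theorem hom_eq_sum (n : ℕ) (f : IntZ) (hf : f ∈ filDeg.fil (-(n : ℤ))) :
    ∃ c : ℕ → ℤ, filDeg.hom n f hf =
      ∑ i ∈ Finset.range (n + 1), c i • (filDeg.t ^ (n - i) * b i) := by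
  obtain ⟨c, hc⟩ := eq_sum_binom f n hf
  refine ⟨c, Subtype.ext ?_⟩
  have h1 : ((filDeg.hom n f hf : ReesIntZ) : IntZ[T;T⁻¹]) = .single (n : ℤ) f := rfl
  rw [h1]
  conv_lhs => rw [hc]
  rw [AddSubmonoidClass.coe_finsetSum]
  have h2 : (AddMonoidAlgebra.single (n : ℤ) (∑ i ∈ Finset.range (n + 1), c i • binom i) : IntZ[T;T⁻¹]) =
      ∑ i ∈ Finset.range (n + 1), .single (n : ℤ) (c i • binom i) :=
    map_sum (AddMonoidAlgebra.singleAddHom (n : ℤ)) _ _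
  rw [h2]
  refine Finset.sum_congr rfl fun i hi => ?_
  have hi' := Finset.mem_range.mp hi
  simp only [b, RingFiltration.t, RingFiltration.hom, Subring.coe_mul, Subring.coe_pow,
    AddSubgroupClass.coe_zsmul, AddMonoidAlgebra.single_pow, AddMonoidAlgebra.single_mul_single,
    one_pow, one_mul, AddMonoidAlgebra.smul_single]
  congr 1
  simp; omega

theorem hom_neg (n : ℤ) (hn : n < 0) (f : IntZ) (hf : f ∈ filDeg.fil (-n)) : f = 0 := by
  refine Subtype.ext (Polynomial.ext fun k => ?_)
  simpa using hf k (by omega)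

theorem span_b : ⊤ ≤ Submodule.span ℤ[X] (Set.range b) := by
  intro r _
  have hr : r = ∑ n ∈ r.1.coeff.support, filDeg.hom n (r.1.coeff n) (r.2 n) := by
    refine Subtype.ext ?_
    rw [AddSubmonoidClass.coe_finsetSum]
    exact (AddMonoidAlgebra.sum_coeff_single r.1).symm
  rw [hr]
  refine sum_mem fun n _ => ?_
  rcases lt_or_ge n 0 with hn | hn
  · have h0 : filDeg.hom n (r.1.coeff n) (r.2 n) = 0 :=
      Subtype.ext (by simp [RingFiltration.hom, hom_neg n hn _ (r.2 n)])
    rw [h0]; exact zero_mem _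
  · lift n to ℕ using hn
    obtain ⟨c, hc⟩ := hom_eq_sum n _ (r.2 n)
    rw [hc]
    refine sum_mem fun i _ => zsmul_mem ?_ _
    rw [← RingFiltration.algebraMap_X, ← map_pow, ← Algebra.smul_def]
    exact Submodule.smul_mem _ _ (Submodule.subset_span ⟨i, rfl⟩)

theorem smul_eq_zero_of (s : ℤ[X]) (n : ℤ) (c : ℤ) (hc : c ≠ 0)
    (h : s • (.single n c : ℤ[T;T⁻¹]) = 0) : s = 0 := by
  rw [Algebra.smul_def, mul_eq_zero, LaurentPolynomial.algebraMap_eq_toLaurent] at h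
  rcases h with h | h
  · exact Polynomial.toLaurent_eq_zero.mp h
  · exact absurd (AddMonoidAlgebra.single_eq_zero.mp h) hc

theorem choose_of_lt {i k : ℕ} (h : ¬ i ≤ k) : Ring.choose (k : ℤ) i = 0 := by
  rw [Ring.choose_natCast, Nat.choose_eq_zero_of_lt (not_le.mp h), Nat.cast_zero]

theorem choose_self (i : ℕ) : Ring.choose (i : ℤ) i = 1 := by
  rw [Ring.choose_natCast, Nat.choose_self, Nat.cast_one]

theorem linearIndependent_b : LinearIndependent ℤ[X] b := by
  rw [linearIndependent_iff']
  intro s g hg i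
  induction i using Nat.strong_induction_on with
  | _ i ih =>
    intro hi
    have h := congrArg (ev i) hg
    rw [map_sum, map_zero, Finset.sum_eq_single i] at h
    · rw [map_smul, ev_b, choose_self] at h
      exact smul_eq_zero_of _ _ _ one_ne_zero h
    · intro j hj hji
      rcases lt_or_gt_of_ne hji with hlt | hlt
      · rw [ih j hlt hj, zero_smul, map_zero]
      · rw [map_smul, ev_b, choose_of_lt (not_le.mpr hlt), AddMonoidAlgebra.single_zero, smul_zero]
    · exact fun h' => absurd hi h'

/-- The Rees algebra is free over `ℤ[t]` on the Hilbert polynomials. -/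
noncomputable def basis : Module.Basis ℕ ℤ[X] ReesIntZ :=
  .mk linearIndependent_b span_b

@[simp] theorem basis_apply (n : ℕ) : basis n = b n := by simp [basis]

theorem eq_zero_of_triangular {ι M : Type} [PartialOrder ι] [AddCommGroup M] [Module ℤ[X] M]
    (β : Module.Basis ι ℤ[X] M) (e : ι → M →ₗ[ℤ[X]] ℤ[T;T⁻¹])
    (h0 : ∀ i k, ¬ i ≤ k → e k (β i) = 0) (h1 : ∀ i (s : ℤ[X]), s • e i (β i) = 0 → s = 0)
    (z : M) (hz : ∀ k, e k z = 0) : z = 0 := by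
  by_contra hne
  have hs : (β.repr z).support.Nonempty := by
    rw [Finsupp.support_nonempty_iff]
    simpa using hne
  obtain ⟨i, hi⟩ := Finset.exists_minimal hs
  have h := hz i
  rw [← β.linearCombination_repr z, Finsupp.linearCombination_apply, Finsupp.sum, map_sum,
    Finset.sum_eq_single i] at h
  · rw [map_smul] at h
    exact (Finsupp.mem_support_iff.mp hi.1) (h1 _ _ h)
  · intro j hj hji
    rw [map_smul, h0 j i, smul_zero]
    intro hle
    exact hji (le_antisymm hle (hi.2 hj hle))
  · exact fun h' => absurd hi.1 h'

theorem ext₁ (z w : ReesIntZ) (h : ∀ k : ℤ, ev k z = ev k w) : z = w := by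
  rw [← sub_eq_zero]
  refine eq_zero_of_triangular basis (fun k : ℕ => (ev k).toLinearMap) ?_ ?_ _ ?_
  · intro i k hik
    simp [ev_b, choose_of_lt hik]
  · intro i s hs
    rw [AlgHom.toLinearMap_apply, basis_apply, ev_b, choose_self] at hs
    exact smul_eq_zero_of _ _ _ one_ne_zero hs
  · intro k
    simp [h]

/-- Specialisation `(x, y) ↦ (k, l)` of the tensor square. -/
noncomputable def ev₂ (k l : ℤ) : ReesIntZ ⊗[ℤ[X]] ReesIntZ →ₐ[ℤ[X]] ℤ[T;T⁻¹] :=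
  Algebra.TensorProduct.productMap (ev k) (ev l)

theorem ext₂ (z w : ReesIntZ ⊗[ℤ[X]] ReesIntZ) (h : ∀ k l : ℤ, ev₂ k l z = ev₂ k l w) :
    z = w := by
  rw [← sub_eq_zero]
  refine eq_zero_of_triangular (basis.tensorProduct basis)
    (fun q : ℕ × ℕ => (ev₂ q.1 q.2).toLinearMap) ?_ ?_ _ ?_
  · rintro ⟨i, j⟩ ⟨k, l⟩ hik
    rw [Prod.mk_le_mk, not_and_or] at hik
    rcases hik with hik | hik <;> simp [ev₂, ev_b, choose_of_lt hik]
  · rintro ⟨i, j⟩ s hs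
    simp only [AlgHom.toLinearMap_apply, Module.Basis.tensorProduct_apply, basis_apply, ev₂,
      Algebra.TensorProduct.productMap_apply_tmul, ev_b, choose_self,
      AddMonoidAlgebra.single_mul_single, mul_one] at hs
    exact smul_eq_zero_of _ _ _ one_ne_zero hs
  · rintro ⟨k, l⟩
    simp [h]

/-- Specialisation of the tensor cube. -/
noncomputable def ev₃ (k l m : ℤ) :
    ReesIntZ ⊗[ℤ[X]] (ReesIntZ ⊗[ℤ[X]] ReesIntZ) →ₐ[ℤ[X]] ℤ[T;T⁻¹] :=
  Algebra.TensorProduct.productMap (ev k) (ev₂ l m)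

theorem ext₃ (z w : ReesIntZ ⊗[ℤ[X]] (ReesIntZ ⊗[ℤ[X]] ReesIntZ))
    (h : ∀ k l m : ℤ, ev₃ k l m z = ev₃ k l m w) : z = w := by
  rw [← sub_eq_zero]
  refine eq_zero_of_triangular (basis.tensorProduct (basis.tensorProduct basis))
    (fun q : ℕ × ℕ × ℕ => (ev₃ q.1 q.2.1 q.2.2).toLinearMap) ?_ ?_ _ ?_
  · rintro ⟨i, j, j'⟩ ⟨k, l, l'⟩ hik
    rw [Prod.mk_le_mk, Prod.mk_le_mk, not_and_or, not_and_or] at hik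
    rcases hik with hik | hik | hik <;> simp [ev₃, ev₂, ev_b, choose_of_lt hik]
  · rintro ⟨i, j, j'⟩ s hs
    simp only [AlgHom.toLinearMap_apply, Module.Basis.tensorProduct_apply, basis_apply, ev₃, ev₂,
      Algebra.TensorProduct.productMap_apply_tmul, ev_b, choose_self,
      AddMonoidAlgebra.single_mul_single, mul_one] at hs
    exact smul_eq_zero_of _ _ _ one_ne_zero hs
  · rintro ⟨k, l, m⟩
    simp [h]

/-- The comultiplication on the basis: `Δ(x choose n) = ∑_{i+j=n} (x choose i) ⊗ (x choose j)`. -/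
noncomputable def comulLin : ReesIntZ →ₗ[ℤ[X]] ReesIntZ ⊗[ℤ[X]] ReesIntZ :=
  basis.constr ℤ[X] fun n => ∑ q ∈ Finset.HasAntidiagonal.antidiagonal n, b q.1 ⊗ₜ[ℤ[X]] b q.2

theorem comulLin_b (n : ℕ) :
    comulLin (b n) = ∑ q ∈ Finset.HasAntidiagonal.antidiagonal n, b q.1 ⊗ₜ[ℤ[X]] b q.2 := by
  rw [← basis_apply, comulLin, Module.Basis.constr_basis]

theorem ev₂_comulLin (k l : ℤ) (r : ReesIntZ) : ev₂ k l (comulLin r) = ev (k + l) r := by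
  have : (ev₂ k l).toLinearMap ∘ₗ comulLin = (ev (k + l)).toLinearMap := by
    refine basis.ext fun n => ?_
    simp only [LinearMap.comp_apply, AlgHom.toLinearMap_apply, basis_apply, comulLin_b, map_sum,
      ev₂, Algebra.TensorProduct.productMap_apply_tmul, ev_b, AddMonoidAlgebra.single_mul_single]
    rw [Ring.add_choose_eq n (Commute.all k l)]
    have h2 : (AddMonoidAlgebra.single (n : ℤ) (∑ q ∈ Finset.HasAntidiagonal.antidiagonal n,
        Ring.choose k q.1 * Ring.choose l q.2) : ℤ[T;T⁻¹]) = ∑ q ∈ Finset.HasAntidiagonal.antidiagonal n,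
        .single (n : ℤ) (Ring.choose k q.1 * Ring.choose l q.2) :=
      map_sum (AddMonoidAlgebra.singleAddHom (n : ℤ)) _ _
    rw [h2]
    refine Finset.sum_congr rfl fun q hq => ?_
    rw [← Nat.cast_add, Finset.HasAntidiagonal.mem_antidiagonal.mp hq]
  exact LinearMap.congr_fun this r

/-- The comultiplication of the Rees algebra: the variable `x` is primitive, i.e. in terms of
specialisations `(Δ f)(k, l) = f(k + l)`. -/
noncomputable def comulHom : ReesIntZ →ₐ[ℤ[X]] ReesIntZ ⊗[ℤ[X]] ReesIntZ :=
  AlgHom.ofLinearMap comulLin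
    (ext₂ _ _ fun k l => by rw [ev₂_comulLin, map_one, map_one])
    (fun r s => ext₂ _ _ fun k l => by
      rw [ev₂_comulLin, map_mul, map_mul, ev₂_comulLin, ev₂_comulLin])

theorem ev₂_comulHom (k l : ℤ) (r : ReesIntZ) : ev₂ k l (comulHom r) = ev (k + l) r :=
  ev₂_comulLin k l r

/-- The counit on the basis: `x ↦ 0`. -/
noncomputable def counitLin : ReesIntZ →ₗ[ℤ[X]] ℤ[X] :=
  basis.constr ℤ[X] fun n => if n = 0 then 1 else 0

theorem algebraMap_counitLin (r : ReesIntZ) : algebraMap ℤ[X] ℤ[T;T⁻¹] (counitLin r) = ev 0 r := by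
  have : (Algebra.linearMap ℤ[X] ℤ[T;T⁻¹]) ∘ₗ counitLin = (ev 0).toLinearMap := by
    refine basis.ext fun n => ?_
    rw [LinearMap.comp_apply, counitLin, Module.Basis.constr_basis, AlgHom.toLinearMap_apply,
      basis_apply, ev_b, Ring.choose_zero_ite]
    split_ifs with h
    · subst h; exact (map_one (algebraMap ℤ[X] ℤ[T;T⁻¹])).trans rfl
    · simp
  exact LinearMap.congr_fun this r

theorem algebraMap_laurent_injective : Function.Injective (algebraMap ℤ[X] ℤ[T;T⁻¹]) :=
  Polynomial.toLaurent_injective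

/-- The counit of the Rees algebra, `x ↦ 0`. -/
noncomputable def counitHom : ReesIntZ →ₐ[ℤ[X]] ℤ[X] :=
  AlgHom.ofLinearMap counitLin
    (algebraMap_laurent_injective (by rw [algebraMap_counitLin, map_one, map_one]))
    (fun r s => algebraMap_laurent_injective (by
      rw [algebraMap_counitLin, map_mul, map_mul, algebraMap_counitLin, algebraMap_counitLin]))

theorem algebraMap_counitHom (r : ReesIntZ) :
    algebraMap ℤ[X] ℤ[T;T⁻¹] (counitHom r) = ev 0 r := algebraMap_counitLin r

/-- The antipode of the Rees algebra, `x ↦ -x`. -/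
noncomputable def antipodeHom : ReesIntZ →ₐ[ℤ[X]] ReesIntZ :=
  { ((AddMonoidAlgebra.mapRingHom ℤ reflect).comp filDeg.rees.subtype).codRestrict filDeg.rees
      (fun r n => by
        rw [RingHom.comp_apply]
        simpa using reflect_mem (r.2 n)) with
    commutes' := fun p => by
      have : (((AddMonoidAlgebra.mapRingHom ℤ reflect).comp filDeg.rees.subtype).codRestrict
          filDeg.rees (fun r n => by
            rw [RingHom.comp_apply]
            simpa using reflect_mem (r.2 n))).comp
          (algebraMap ℤ[X] ReesIntZ) = algebraMap ℤ[X] ReesIntZ := by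
        refine Polynomial.ringHom_ext (fun n => by simp) ?_
        rw [RingHom.comp_apply, RingFiltration.algebraMap_X]
        refine Subtype.ext ?_
        exact mapRingHom_single _ _ _ |>.trans (by rw [map_one]; rfl)
      exact RingHom.congr_fun this p }

theorem antipodeHom_hom (n : ℤ) (f : IntZ) (hf : f ∈ filDeg.fil (-n)) :
    antipodeHom (filDeg.hom n f hf) = filDeg.hom n (reflect f) (reflect_mem hf) := by
  refine Subtype.ext ?_
  exact mapRingHom_single _ _ _

theorem ev_antipodeHom (k : ℤ) (r : ReesIntZ) : ev k (antipodeHom r) = ev (-k) r := by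
  change AddMonoidAlgebra.mapRingHom ℤ (IntZ.ev k) (AddMonoidAlgebra.mapRingHom ℤ reflect r.1) =
    AddMonoidAlgebra.mapRingHom ℤ (IntZ.ev (-k)) r.1
  refine LaurentPolynomial.ext fun n => ?_
  simp [ev_reflect]

noncomputable instance : Bialgebra ℤ[X] ReesIntZ :=
  Bialgebra.ofAlgHom comulHom counitHom
    (by
      refine AlgHom.ext fun r => ext₃ _ _ fun k l m => ?_
      have h1 : ∀ z : ReesIntZ ⊗[ℤ[X]] ReesIntZ, ev₃ k l m
          (Algebra.TensorProduct.assoc ℤ[X] ℤ[X] ℤ[X] ReesIntZ ReesIntZ ReesIntZ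
            (Algebra.TensorProduct.map comulHom (.id ℤ[X] ReesIntZ) z)) = ev₂ (k + l) m z := by
        intro z
        induction z with
        | zero => simp
        | add x y hx hy => simp only [map_add, hx, hy]
        | tmul x y =>
          have h3 : ∀ (w : ReesIntZ ⊗[ℤ[X]] ReesIntZ), ev₃ k l m
              (Algebra.TensorProduct.assoc ℤ[X] ℤ[X] ℤ[X] ReesIntZ ReesIntZ ReesIntZ
                (w ⊗ₜ y)) = ev₂ k l w * ev m y := by
            intro w
            induction w with
            | zero => simp
            | add x y hx hy => simp only [TensorProduct.add_tmul, map_add, hx, hy, add_mul]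
            | tmul a c => simp [ev₃, ev₂, mul_assoc]
          refine (h3 (comulHom x)).trans ?_
          rw [ev₂_comulHom]
          simp [ev₂]
      have h2 : ∀ z : ReesIntZ ⊗[ℤ[X]] ReesIntZ, ev₃ k l m
          (Algebra.TensorProduct.map (.id ℤ[X] ReesIntZ) comulHom z) = ev₂ k (l + m) z := by
        intro z
        induction z with
        | zero => simp
        | add x y hx hy => simp only [map_add, hx, hy]
        | tmul x y =>
          rw [Algebra.TensorProduct.map_tmul, ev₃, Algebra.TensorProduct.productMap_apply_tmul,
            ev₂_comulHom]
          simp [ev₂]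
      refine (h1 (comulHom r)).trans (Eq.trans ?_ (h2 (comulHom r)).symm)
      rw [ev₂_comulHom, ev₂_comulHom, add_assoc])
    (by
      refine AlgHom.ext fun r => (Algebra.TensorProduct.lid ℤ[X] ReesIntZ).injective
        (ext₁ _ _ fun k => ?_)
      have h1 : ∀ z : ReesIntZ ⊗[ℤ[X]] ReesIntZ, ev k (Algebra.TensorProduct.lid ℤ[X] ReesIntZ
          (Algebra.TensorProduct.map counitHom (.id ℤ[X] ReesIntZ) z)) = ev₂ 0 k z := by
        intro z
        induction z with
        | zero => simp
        | add x y hx hy => simp only [map_add, hx, hy]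
        | tmul x y => simp [ev₂, ← algebraMap_counitHom, Algebra.smul_def]
      refine (h1 _).trans ((ev₂_comulHom _ _ _).trans ?_)
      rw [zero_add]
      simp)
    (by
      refine AlgHom.ext fun r => (Algebra.TensorProduct.rid ℤ[X] ℤ[X] ReesIntZ).injective
        (ext₁ _ _ fun k => ?_)
      have h1 : ∀ z : ReesIntZ ⊗[ℤ[X]] ReesIntZ, ev k (Algebra.TensorProduct.rid ℤ[X] ℤ[X] ReesIntZ
          (Algebra.TensorProduct.map (.id ℤ[X] ReesIntZ) counitHom z)) = ev₂ k 0 z := by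
        intro z
        induction z with
        | zero => simp
        | add x y hx hy => simp only [map_add, hx, hy]
        | tmul x y => simp [ev₂, ← algebraMap_counitHom, Algebra.smul_def, mul_comm]
      refine (h1 _).trans ((ev₂_comulHom _ _ _).trans ?_)
      rw [add_zero]
      simp)

/-- The Hopf algebra structure on the Rees algebra for which `x` is primitive. -/
noncomputable instance : HopfAlgebra ℤ[X] ReesIntZ :=
  HopfAlgebra.ofAlgHom antipodeHom
    (by
      refine AlgHom.ext fun r => ext₁ _ _ fun k => ?_
      have h1 : ∀ z : ReesIntZ ⊗[ℤ[X]] ReesIntZ, ev k (Algebra.TensorProduct.lift antipodeHom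
          (.id ℤ[X] ReesIntZ) (fun _ _ => Commute.all _ _) z) = ev₂ (-k) k z := by
        intro z
        induction z with
        | zero => simp
        | add x y hx hy => simp only [map_add, hx, hy]
        | tmul x y =>
          rw [Algebra.TensorProduct.lift_tmul, map_mul, ev₂,
            Algebra.TensorProduct.productMap_apply_tmul]
          simp [ev_antipodeHom]
      refine (h1 _).trans ((ev₂_comulHom _ _ _).trans ?_)
      rw [neg_add_cancel, ← algebraMap_counitHom]
      exact ((ev k).commutes _).symm)
    (by
      refine AlgHom.ext fun r => ext₁ _ _ fun k => ?_
      have h1 : ∀ z : ReesIntZ ⊗[ℤ[X]] ReesIntZ, ev k (Algebra.TensorProduct.lift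
          (.id ℤ[X] ReesIntZ) antipodeHom (fun _ _ => Commute.all _ _) z) = ev₂ k (-k) z := by
        intro z
        induction z with
        | zero => simp
        | add x y hx hy => simp only [map_add, hx, hy]
        | tmul x y =>
          rw [Algebra.TensorProduct.lift_tmul, map_mul, ev₂,
            Algebra.TensorProduct.productMap_apply_tmul]
          simp [ev_antipodeHom]
      refine (h1 _).trans ((ev₂_comulHom _ _ _).trans ?_)
      rw [add_neg_cancel, ← algebraMap_counitHom]
      exact ((ev k).commutes _).symm)

instance : Coalgebra.IsCocomm ℤ[X] ReesIntZ where
  comm_comp_comul := by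
    refine LinearMap.ext fun r => ext₂ _ _ fun k l => ?_
    have h1 : ∀ z : ReesIntZ ⊗[ℤ[X]] ReesIntZ,
        ev₂ k l (TensorProduct.comm ℤ[X] ReesIntZ ReesIntZ z) = ev₂ l k z := by
      intro z
      induction z with
      | zero => simp
      | add x y hx hy => simp only [map_add, hx, hy]
      | tmul x y => simp [ev₂, mul_comm]
    refine (h1 _).trans ((ev₂_comulHom _ _ _).trans ?_)
    rw [add_comm]
    exact (ev₂_comulHom _ _ _).symm

theorem comul_b (n : ℕ) : Coalgebra.comul (R := ℤ[X]) (b n) =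
    ∑ q ∈ Finset.HasAntidiagonal.antidiagonal n, b q.1 ⊗ₜ[ℤ[X]] b q.2 := comulLin_b n

theorem counit_b (n : ℕ) : Coalgebra.counit (R := ℤ[X]) (b n) = if n = 0 then 1 else 0 := by
  change counitLin (b n) = _
  rw [← basis_apply, counitLin, Module.Basis.constr_basis]

end ReesIntZ

/-! ### The quotient stacks `[X / 𝔾_m]` -/

/-- A coaction `ρ : B → B[T, T⁻¹]` makes a unit `u ∈ 𝔾_m(R) = Rˣ` act on the `R`-points of `Spec B`:
`u • χ = (B → B[T, T⁻¹] → R)`, the second map being `χ` on `B` and `T ↦ u`. -/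
noncomputable def coactPoint {B R : Type u} [CommRing B] [CommRing R] (ρ : B →+* B[T;T⁻¹])
    (u : Rˣ) (χ : B →+* R) : B →+* R :=
  (LaurentPolynomial.eval₂ χ u).comp ρ

theorem unit_zpow_eq_T {B : Type u} [CommRing B] (τ : (B[T;T⁻¹])ˣ)
    (hτ : (τ : B[T;T⁻¹]) = LaurentPolynomial.T 1) (n : ℤ) :
    ((τ ^ n : (B[T;T⁻¹])ˣ) : B[T;T⁻¹]) = LaurentPolynomial.T n := by
  have h : ∀ m : ℕ, ((τ ^ m : (B[T;T⁻¹])ˣ) : B[T;T⁻¹]) = LaurentPolynomial.T m := fun m => by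
    rw [Units.val_pow_eq_pow_val, hτ, LaurentPolynomial.T_pow, mul_one]
  obtain ⟨m, rfl | rfl⟩ := n.eq_nat_or_neg
  · rw [zpow_natCast, h]
  · rw [zpow_neg, zpow_natCast]
    refine (τ ^ m).isUnit.mul_left_cancel ?_
    rw [Units.mul_inv, h, ← LaurentPolynomial.T_add, add_neg_cancel, LaurentPolynomial.T_zero]

theorem eval₂_C_T {B : Type u} [CommRing B] :
    LaurentPolynomial.eval₂ (LaurentPolynomial.C (R := B)) (LaurentPolynomial.isUnit_T 1).unit =
      RingHom.id _ := by
  refine RingHom.ext fun f => ?_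
  induction f using LaurentPolynomial.induction_on' with
  | add p q hp hq => rw [map_add, hp, hq, map_add]
  | C_mul_T n a =>
    rw [LaurentPolynomial.eval₂_C_mul_T, RingHom.id_apply]
    rw [unit_zpow_eq_T _ (IsUnit.unit_spec _)]

theorem eval₂_mapRingHom {B B' R : Type u} [CommRing B] [CommRing B'] [CommRing R] (f : B →+* B')
    (χ : B' →+* R) (w : Rˣ) (p : B[T;T⁻¹]) :
    LaurentPolynomial.eval₂ χ w (AddMonoidAlgebra.mapRingHom ℤ f p) =
      LaurentPolynomial.eval₂ (χ.comp f) w p := by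
  induction p using LaurentPolynomial.induction_on' with
  | add p q hp hq => simp only [map_add, hp, hq]
  | C_mul_T n a =>
    rw [← LaurentPolynomial.single_eq_C_mul_T, ReesIntZ.mapRingHom_single,
      LaurentPolynomial.single_eq_C_mul_T, LaurentPolynomial.single_eq_C_mul_T,
      LaurentPolynomial.eval₂_C_mul_T, LaurentPolynomial.eval₂_C_mul_T, RingHom.comp_apply]

/-- An fpqc `𝔾_m`-torsor `P → Spec A`. It is affine over `Spec A`, so it is given by an
`A`-algebra `B` (`P = Spec B`) with a coaction of `ℤ[T, T⁻¹]`, such that `P → Spec A` is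
faithfully flat and `P × 𝔾_m → P ×_A P`, `(p, u) ↦ (p, u • p)`, is an isomorphism. -/
structure GmTorsor (A : Type u) [CommRing A] where
  ring : Type u
  [commRing : CommRing ring]
  [algebra : Algebra A ring]
  coact : ring →ₐ[A] ring[T;T⁻¹]
  one_act : ∀ (R : Type u) [CommRing R] (χ : ring →+* R),
    coactPoint coact.toRingHom 1 χ = χ
  mul_act : ∀ (R : Type u) [CommRing R] (u v : Rˣ) (χ : ring →+* R),
    coactPoint coact.toRingHom (u * v) χ =
      coactPoint coact.toRingHom u (coactPoint coact.toRingHom v χ)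
  faithfullyFlat : Module.FaithfullyFlat A ring
  bijective_shear : Function.Bijective
    (Algebra.TensorProduct.productMap (IsScalarTower.toAlgHom A ring ring[T;T⁻¹]) coact :
      ring ⊗[A] ring →ₐ[A] ring[T;T⁻¹])

attribute [instance] GmTorsor.commRing GmTorsor.algebra

namespace GmTorsor

variable {A : Type u} [CommRing A] (P : GmTorsor A)

/-- The action of `u ∈ 𝔾_m(R)` on an `R`-point `χ` of the torsor. -/
noncomputable def act {R : Type u} [CommRing R] (u : Rˣ) (χ : P.ring →+* R) : P.ring →+* R :=
  coactPoint P.coact.toRingHom u χ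

/-- The weight `n` part of the coordinate ring of a torsor. -/
def weight (n : ℤ) : AddSubgroup P.ring where
  carrier := {y | P.coact y = LaurentPolynomial.C y * LaurentPolynomial.T n}
  zero_mem' := by simp
  add_mem' {y z} hy hz := by
    simp only [Set.mem_ofPred_eq] at hy hz ⊢
    rw [map_add, hy, hz, map_add, add_mul]
  neg_mem' {y} hy := by
    simp only [Set.mem_ofPred_eq] at hy ⊢
    rw [map_neg, hy, map_neg, neg_mul]

theorem mem_weight {n : ℤ} {y : P.ring} :
    y ∈ P.weight n ↔ P.coact y = LaurentPolynomial.C y * LaurentPolynomial.T n := Iff.rfl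

theorem one_mem_weight : (1 : P.ring) ∈ P.weight 0 := by
  rw [mem_weight]; simp

theorem mul_mem_weight {m n : ℤ} {y z : P.ring} (hy : y ∈ P.weight m) (hz : z ∈ P.weight n) :
    y * z ∈ P.weight (m + n) := by
  rw [mem_weight] at *
  rw [map_mul, hy, hz, map_mul, LaurentPolynomial.T_add]
  ring

end GmTorsor

/-- A functor from commutative rings to sets with an action of `𝔾_m`. -/
structure GmFunctor where
  pts : ∀ (R : Type u) [CommRing R], Type u
  map : ∀ {R S : Type u} [CommRing R] [CommRing S], (R →+* S) → pts R → pts S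
  map_id : ∀ {R : Type u} [CommRing R] (x : pts R), map (RingHom.id R) x = x
  map_comp : ∀ {R S S' : Type u} [CommRing R] [CommRing S] [CommRing S'] (f : R →+* S)
    (g : S →+* S') (x : pts R), map (g.comp f) x = map g (map f x)
  act : ∀ {R : Type u} [CommRing R], Rˣ → pts R → pts R
  one_act : ∀ {R : Type u} [CommRing R] (x : pts R), act 1 x = x
  mul_act : ∀ {R : Type u} [CommRing R] (u v : Rˣ) (x : pts R), act (u * v) x = act u (act v x)
  map_act : ∀ {R S : Type u} [CommRing R] [CommRing S] (f : R →+* S) (u : Rˣ) (x : pts R),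
    map f (act u x) = act (Units.map f u) (map f x)

/-- A `𝔾_m`-equivariant morphism of functors. -/
structure GmFunctor.Hom (X Y : GmFunctor.{u}) where
  app : ∀ {R : Type u} [CommRing R], X.pts R → Y.pts R
  natural : ∀ {R S : Type u} [CommRing R] [CommRing S] (f : R →+* S) (x : X.pts R),
    app (X.map f x) = Y.map f (app x)
  equivariant : ∀ {R : Type u} [CommRing R] (u : Rˣ) (x : X.pts R), app (X.act u x) = Y.act u (app x)

/-- The morphism `P → X` corresponding, by the Yoneda lemma, to a point of `X` with values in the
coordinate ring of `P`, is `𝔾_m`-equivariant. -/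
def GmTorsor.IsEquivariant {A : Type u} [CommRing A] (P : GmTorsor A) (X : GmFunctor.{u})
    (y : X.pts P.ring) : Prop :=
  ∀ (R : Type u) [CommRing R] (u : Rˣ) (χ : P.ring →+* R), X.map (P.act u χ) y = X.act u (X.map χ y)

/-- Objects of the quotient stack `[X / 𝔾_m]` over affine schemes: an affine scheme `Spec A`, a
`𝔾_m`-torsor `P → Spec A` and a `𝔾_m`-equivariant morphism `P → X`. -/
structure QuotStack (X : GmFunctor.{u}) where
  base : Type u
  [commRing : CommRing base]
  P : GmTorsor base
  pt : X.pts P.ring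
  equivariant : P.IsEquivariant X pt

attribute [instance] QuotStack.commRing

namespace QuotStack

variable {X Y : GmFunctor.{u}}

/-- A morphism from the object over `Spec A` to the object over `Spec A'`, written in terms of rings
(so that `[X / 𝔾_m]` as a category fibred in groupoids over affine schemes is the opposite of
`QuotStack X`): a map `Spec A' → Spec A` covered by an equivariant map `P' → P` over `X`. As `P` and
`P'` are torsors, the square formed by these maps is automatically cartesian. -/
@[ext] structure Hom (x y : QuotStack X) where
  base : x.base →+* y.base
  total : x.P.ring →+* y.P.ring
  comm : ∀ a, total (algebraMap x.base x.P.ring a) = algebraMap y.base y.P.ring (base a)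
  coact : ∀ b, y.P.coact (total b) = AddMonoidAlgebra.mapRingHom ℤ total (x.P.coact b)
  pt : X.map total x.pt = y.pt

theorem Hom.act_comp {x y : QuotStack X} (f : Hom x y) {R : Type u} [CommRing R] (w : Rˣ)
    (χ : y.P.ring →+* R) : (y.P.act w χ).comp f.total = x.P.act w (χ.comp f.total) := by
  refine RingHom.ext fun b => ?_
  change LaurentPolynomial.eval₂ χ w (y.P.coact (f.total b)) = _
  rw [f.coact, eval₂_mapRingHom]
  rfl

theorem Hom.isEquivariant {x y : QuotStack X} (f : Hom x y) {Z : GmFunctor.{u}} {z : Z.pts x.P.ring}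
    (hz : x.P.IsEquivariant Z z) : y.P.IsEquivariant Z (Z.map f.total z) := fun R _ w χ => by
  rw [← Z.map_comp, f.act_comp, hz R w, Z.map_comp]

instance : CategoryTheory.Category (QuotStack X) where
  Hom := Hom
  id x :=
    { base := RingHom.id _
      total := RingHom.id _
      comm := fun _ => rfl
      coact := fun b => by
        refine LaurentPolynomial.ext fun n => ?_
        simp
      pt := X.map_id _ }
  comp {x y z} f g :=
    { base := g.base.comp f.base
      total := g.total.comp f.total
      comm := fun a => by simp [f.comm, g.comm]
      coact := fun b => by
        rw [RingHom.comp_apply, g.coact, f.coact]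
        refine LaurentPolynomial.ext fun n => ?_
        simp
      pt := by rw [X.map_comp, f.pt, g.pt] }

/-- The morphism of quotient stacks induced by an equivariant morphism. -/
def map (p : X.Hom Y) : CategoryTheory.Functor (QuotStack X) (QuotStack Y) where
  obj x :=
    { base := x.base
      P := x.P
      pt := p.app x.pt
      equivariant := fun R _ u χ => by
        rw [← p.natural, x.equivariant R u χ, p.equivariant, p.natural] }
  map f :=
    { base := f.base
      total := f.total
      comm := f.comm
      coact := f.coact
      pt := by rw [← p.natural, f.pt] }

end QuotStack

/-! ### The stack `𝔸¹ / 𝔾_m` -/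

/-- The affine line with its standard `𝔾_m`-action by multiplication. -/
def affineLine : GmFunctor.{u} where
  pts R _ := R
  map f := f
  map_id _ := rfl
  map_comp _ _ _ := rfl
  act u x := u * x
  one_act x := by simp
  mul_act u v x := by simp [mul_assoc]
  map_act f u x := by simp

/-- The stack `𝔸¹ / 𝔾_m`. -/
abbrev A1modGm := QuotStack affineLine.{u}

namespace A1modGm

/-- The coordinate ring of the torsor of a point of `𝔸¹ / 𝔾_m`; it is an algebra over
`ℤ[t] = 𝒪(𝔸¹)` through the equivariant map to `𝔸¹`. -/
def ring (x : A1modGm.{u}) : Type u := x.P.ring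

instance (x : A1modGm.{u}) : CommRing x.ring := x.P.commRing

/-- The function `t` on the torsor. -/
def s (x : A1modGm.{u}) : x.ring := x.pt

noncomputable instance (x : A1modGm.{u}) : Algebra ℤ[X] x.ring :=
  (Polynomial.aeval x.s).toRingHom.toAlgebra

theorem algebraMap_X (x : A1modGm.{u}) : algebraMap ℤ[X] x.ring X = x.s := Polynomial.aeval_X _

/-- The weight `n` part of the coordinate ring of the torsor. -/
def weight (x : A1modGm.{u}) (n : ℤ) : AddSubgroup x.ring := x.P.weight n

theorem one_mem_weight (x : A1modGm.{u}) : (1 : x.ring) ∈ x.weight 0 := x.P.one_mem_weight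

theorem mul_mem_weight (x : A1modGm.{u}) {m n : ℤ} {y z : x.ring} (hy : y ∈ x.weight m)
    (hz : z ∈ x.weight n) : y * z ∈ x.weight (m + n) := x.P.mul_mem_weight hy hz

theorem s_mem_weight (x : A1modGm.{u}) : x.s ∈ x.weight 1 := by
  let τ : (x.P.ring[T;T⁻¹])ˣ := (LaurentPolynomial.isUnit_T 1).unit
  have h := x.equivariant x.P.ring[T;T⁻¹] τ LaurentPolynomial.C
  have h3 : x.P.act τ LaurentPolynomial.C = x.P.coact.toRingHom := by
    rw [GmTorsor.act, coactPoint, eval₂_C_T, RingHom.id_comp]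
  rw [h3] at h
  change x.P.coact x.pt = LaurentPolynomial.T 1 *
    LaurentPolynomial.C (R := x.P.ring) x.pt at h
  exact h.trans (mul_comm _ _)

theorem pow_mem_weight (x : A1modGm.{u}) (n : ℕ) : x.s ^ n ∈ x.weight n := by
  induction n with
  | zero => simpa using x.one_mem_weight
  | succ n ih =>
    rw [pow_succ, Nat.cast_succ]
    exact x.mul_mem_weight ih x.s_mem_weight

/-- The map of coordinate rings of the torsors induced by a morphism. -/
noncomputable def ringMap {x y : A1modGm.{u}} (f : x ⟶ y) : x.ring →ₐ[ℤ[X]] y.ring :=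
  let g : x.ring →+* y.ring := QuotStack.Hom.total f
  { g with
    commutes' := fun p => by
      have : g.comp (algebraMap ℤ[X] x.ring) = algebraMap ℤ[X] y.ring := by
        refine Polynomial.ringHom_ext' (Subsingleton.elim _ _) ?_
        rw [RingHom.comp_apply, algebraMap_X, algebraMap_X]
        exact QuotStack.Hom.pt f
      exact RingHom.congr_fun this p }

theorem ringMap_mem_weight {x y : A1modGm.{u}} (f : x ⟶ y) {n : ℤ} {a : x.ring}
    (ha : a ∈ x.weight n) : ringMap f a ∈ y.weight n := by
  have h := QuotStack.Hom.coact f a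
  change y.P.coact (QuotStack.Hom.total f a) = _
  have ha' : x.P.coact a = AddMonoidAlgebra.single n a :=
    Eq.trans ha (LaurentPolynomial.single_eq_C_mul_T _ _).symm
  rw [h, ha']
  refine (ReesIntZ.mapRingHom_single _ _ _).trans ?_
  exact LaurentPolynomial.single_eq_C_mul_T _ _

end A1modGm

/-! ### The filtered stack `fSpec` -/

/-- The points of `fSpec F = Spec_{𝔸¹/𝔾_m}(Rees F)` over a point `x : Spec A → 𝔸¹/𝔾_m`. A
quasi-coherent algebra on `𝔸¹/𝔾_m` is a graded `ℤ[t]`-algebra (`t` of weight `1`), the direct image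
`x_* 𝒪_{Spec A}` is the graded coordinate ring of the torsor of `x`, and the points of the relative
spectrum of `Rees F` are the algebra maps `Rees F → x_* 𝒪_{Spec A}`: the homomorphisms of `ℤ[t]`-algebras
that preserve the grading. -/
def RingFiltration.fSpec {R : Type} [CommRing R] (F : RingFiltration R) (x : A1modGm.{u}) :
    Set (F.rees →ₐ[ℤ[X]] x.ring) :=
  {φ | ∀ (n : ℤ) (a : R) (ha : a ∈ F.fil (-n)), φ (F.hom n a ha) ∈ x.weight n}

/-! ### The group `ℍ_fil` -/

open WithConv CategoryTheory

/-- The group of points of the group scheme `Spec (Rees (fil_deg Int(ℤ)))` over `𝔸¹`, with the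
convolution product coming from the Hopf algebra structure. -/
noncomputable instance {B : Type u} [CommRing B] [Algebra ℤ[X] B] :
    CommGroup (WithConv (ReesIntZ →ₐ[ℤ[X]] B)) :=
  { (inferInstance : CommMonoid (WithConv (ReesIntZ →ₐ[ℤ[X]] B))) with
    inv := fun φ => toConv (φ.ofConv.comp (HopfAlgebra.antipodeAlgHom ℤ[X] ReesIntZ))
    inv_mul_cancel := fun φ => by
      refine WithConv.ofConv_injective (AlgHom.ext fun r => ?_)
      refine (AlgHom.convMul_apply _ _ r).trans ?_
      have h1 : ∀ z : ReesIntZ ⊗[ℤ[X]] ReesIntZ, Algebra.TensorProduct.lift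
          (φ.ofConv.comp (HopfAlgebra.antipodeAlgHom ℤ[X] ReesIntZ)) φ.ofConv
          (fun _ _ => Commute.all _ _) z = φ.ofConv (LinearMap.mul' ℤ[X] ReesIntZ
            ((HopfAlgebra.antipode ℤ[X]).rTensor ReesIntZ z)) := by
        intro z
        induction z with
        | zero => simp
        | add x y hx hy => simp only [map_add, hx, hy]
        | tmul x y => simp
      refine (h1 _).trans ?_
      rw [HopfAlgebra.mul_antipode_rTensor_comul_apply, AlgHom.commutes]
      rfl }

theorem ReesIntZ.mem_fSpec_iff (x : A1modGm.{u}) (φ : ReesIntZ →ₐ[ℤ[X]] x.ring) :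
    φ ∈ IntZ.filDeg.fSpec x ↔ ∀ n : ℕ, φ (b n) ∈ x.weight n := by
  refine ⟨fun h n => h n _ _, fun h n a ha => ?_⟩
  rcases lt_or_ge n 0 with hn | hn
  · have h0 : IntZ.filDeg.hom n a ha = 0 :=
      Subtype.ext (by simp [RingFiltration.hom, hom_neg n hn a ha])
    rw [h0, map_zero]
    exact zero_mem _
  · lift n to ℕ using hn
    obtain ⟨c, hc⟩ := hom_eq_sum n a ha
    rw [hc, map_sum]
    refine sum_mem fun i hi => ?_
    rw [map_zsmul, map_mul, map_pow, ← RingFiltration.algebraMap_X, AlgHom.commutes,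
      A1modGm.algebraMap_X]
    refine zsmul_mem ?_ _
    have := x.mul_mem_weight (x.pow_mem_weight (n - i)) (h i)
    have hi' := Finset.mem_range.mp hi
    rwa [← Nat.cast_add, Nat.sub_add_cancel (by omega)] at this

/-- The group of points of `ℍ_fil = fSpec (fil_deg Int(ℤ))` over a point of `𝔸¹/𝔾_m`; the group
law is induced by the Hopf algebra structure on `Int(ℤ)` for which `x` is primitive. -/
noncomputable def HfilPts (x : A1modGm.{u}) : Subgroup (WithConv (ReesIntZ →ₐ[ℤ[X]] x.ring)) where
  carrier := {φ | φ.ofConv ∈ IntZ.filDeg.fSpec x}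
  one_mem' := by
    refine (ReesIntZ.mem_fSpec_iff x _).mpr fun n => ?_
    have : (1 : WithConv (ReesIntZ →ₐ[ℤ[X]] x.ring)).ofConv (ReesIntZ.b n) =
        algebraMap ℤ[X] x.ring (Coalgebra.counit (R := ℤ[X]) (ReesIntZ.b n)) := rfl
    rw [this, ReesIntZ.counit_b]
    split_ifs with h
    · subst h; rw [map_one]; exact x.one_mem_weight
    · rw [map_zero]; exact zero_mem _
  mul_mem' {φ ψ} hφ hψ := by
    refine (ReesIntZ.mem_fSpec_iff x _).mpr fun n => ?_
    have h : (φ * ψ).ofConv (ReesIntZ.b n) = _ := AlgHom.convMul_apply φ ψ (ReesIntZ.b n)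
    rw [h, ReesIntZ.comul_b, map_sum]
    refine sum_mem fun q hq => ?_
    rw [Algebra.TensorProduct.lift_tmul, ← Finset.HasAntidiagonal.mem_antidiagonal.mp hq, Nat.cast_add]
    exact x.mul_mem_weight ((ReesIntZ.mem_fSpec_iff x _).mp hφ _)
      ((ReesIntZ.mem_fSpec_iff x _).mp hψ _)
  inv_mem' {φ} hφ n a ha := by
    have h : (φ⁻¹).ofConv (IntZ.filDeg.hom n a ha) =
        φ.ofConv (ReesIntZ.antipodeHom (IntZ.filDeg.hom n a ha)) := rfl
    rw [h, ReesIntZ.antipodeHom_hom]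
    exact hφ n _ _

/-- The filtered Hilbert additive group `ℍ_fil = fSpec (fil_deg Int(ℤ))` as a commutative group over
the stack `𝔸¹/𝔾_m`, that is, as a functor to abelian groups on the category of points of `𝔸¹/𝔾_m`. -/
noncomputable def Hfil : A1modGm.{u} ⥤ AddCommGrpCat.{u} where
  obj x := AddCommGrpCat.of (Additive (HfilPts x))
  map f := AddCommGrpCat.ofHom (MonoidHom.toAdditive
    { toFun := fun φ => ⟨toConv ((A1modGm.ringMap f).comp φ.1.ofConv), fun n a ha =>
        A1modGm.ringMap_mem_weight f (φ.2 n a ha)⟩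
      map_one' := Subtype.ext (WithConv.ofConv_injective (AlgHom.ext fun _ =>
        (A1modGm.ringMap f).commutes _))
      map_mul' := fun φ ψ => Subtype.ext (WithConv.ofConv_injective
        (AlgHom.comp_convMul_distrib (A1modGm.ringMap f) φ.1 ψ.1)) })
  map_id _ := rfl
  map_comp _ _ := rfl

/-! ### The group `ℍ^t / 𝔾_m` -/

/-- `ℍ^t ⊆ 𝕎 × 𝔸¹`: the pairs `(f, a)` killed by all the maps `Frob_n - [a]^{n-1}`, with `𝔾_m` acting
diagonally, `u • (f, a) = ([u] f, u a)`. -/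
noncomputable def Ht : GmFunctor.{u} where
  pts R _ := {q : BigWitt R × R // ∀ n : ℕ+,
    BigWitt.frob n q.1 - BigWitt.teich q.2 ^ ((n : ℕ) - 1) * q.1 = 0}
  map f q := ⟨(BigWitt.map f q.1.1, f q.1.2), fun n => by
    rw [← BigWitt.map_frob, ← BigWitt.map_teich, ← map_pow, ← map_mul, ← map_sub, q.2 n, map_zero]⟩
  map_id q := rfl
  map_comp f g q := rfl
  act {R} _ u q := ⟨(BigWitt.teich (u : R) * q.1.1, u * q.1.2), fun n => by
    have h := sub_eq_zero.mp (q.2 n)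
    have hn : (n : ℕ) = (n : ℕ) - 1 + 1 := (Nat.succ_pred_eq_of_pos n.pos).symm
    rw [map_mul, BigWitt.frob_teich, h, map_mul, mul_pow, sub_eq_zero]
    conv_lhs => rw [hn, pow_succ]
    simp only [Nat.add_sub_cancel]
    ring⟩
  one_act q := Subtype.ext (Prod.ext (by simp) (by simp))
  mul_act u v q := Subtype.ext (Prod.ext (by simp [mul_assoc]) (by simp [mul_assoc]))
  map_act f u q := Subtype.ext (Prod.ext (by simp [BigWitt.map_teich]) (by simp))

/-- The equivariant projection `ℍ^t → 𝔸¹`. -/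
def Ht.proj : Ht.{u}.Hom affineLine where
  app q := q.1.2
  natural _ _ := rfl
  equivariant _ _ := rfl

/-- The points of `ℍ^t/𝔾_m → 𝔸¹/𝔾_m` over a point `(P → Spec A, s : P → 𝔸¹)` of `𝔸¹/𝔾_m`: the equivariant
maps `(f, s) : P → ℍ^t` lifting `s`. They form a group under addition of `f`. -/
def HtPts (x : A1modGm.{u}) : AddSubgroup (BigWitt x.P.ring) where
  carrier := {f | ∃ q : Ht.pts x.P.ring, q.1 = (f, x.pt) ∧ x.P.IsEquivariant Ht q}
  zero_mem' := ⟨⟨(0, x.pt), fun n => by simp⟩, rfl, fun R _ u χ => Subtype.ext (Prod.ext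
    (by simp [Ht]) (x.equivariant R u χ))⟩
  add_mem' := by
    rintro f g ⟨q, hq, hq'⟩ ⟨r, hr, hr'⟩
    refine ⟨⟨(f + g, x.pt), fun n => ?_⟩, rfl, fun R _ u χ => Subtype.ext (Prod.ext ?_
      (x.equivariant R u χ))⟩
    · have h1 := q.2 n
      have h2 := r.2 n
      rw [hq] at h1
      rw [hr] at h2
      dsimp only at h1 h2 ⊢
      rw [map_add, mul_add, add_sub_add_comm, h1, h2, add_zero]
    · have h1 := congrArg (fun z => z.1.1) (hq' R u χ)
      have h2 := congrArg (fun z => z.1.1) (hr' R u χ)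
      simp only [Ht, hq, hr] at h1 h2 ⊢
      rw [map_add, map_add, h1, h2, mul_add]
  neg_mem' := by
    rintro f ⟨q, hq, hq'⟩
    refine ⟨⟨(-f, x.pt), fun n => ?_⟩, rfl, fun R _ u χ => Subtype.ext (Prod.ext ?_
      (x.equivariant R u χ))⟩
    · have h1 := q.2 n
      rw [hq] at h1
      dsimp only at h1 ⊢
      rw [map_neg, mul_neg, sub_neg_eq_add, neg_add_eq_sub, ← neg_sub, h1, neg_zero]
    · have h1 := congrArg (fun z => z.1.1) (hq' R u χ)
      simp only [Ht, hq] at h1 ⊢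
      rw [map_neg, map_neg, h1, mul_neg]

/-- The equivariant morphism `P → ℍ^t` given by an element of `HtPts x`. -/
noncomputable def HtPts.lift {x : A1modGm.{u}} {f : BigWitt x.P.ring} (hf : f ∈ HtPts x) :
    Ht.pts x.P.ring :=
  ⟨(f, x.pt), by
    obtain ⟨q, hq, _⟩ := hf
    have h := q.2
    rw [hq] at h
    exact h⟩

theorem HtPts.lift_isEquivariant {x : A1modGm.{u}} {f : BigWitt x.P.ring} (hf : f ∈ HtPts x) :
    x.P.IsEquivariant Ht (HtPts.lift hf) := by
  obtain ⟨q, hq, hq'⟩ := hf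
  have : HtPts.lift ⟨q, hq, hq'⟩ = q := Subtype.ext hq.symm
  rw [this]; exact hq'

/-- The commutative group `ℍ^t / 𝔾_m` over `𝔸¹/𝔾_m`. -/
noncomputable def HtmodGm : A1modGm.{u} ⥤ AddCommGrpCat.{u} where
  obj x := AddCommGrpCat.of (HtPts x)
  map g := AddCommGrpCat.ofHom
    { toFun := fun f => ⟨BigWitt.map (QuotStack.Hom.total g) f.1, by
        obtain ⟨q, hq, hq'⟩ := f.2
        refine ⟨Ht.map (QuotStack.Hom.total g) q, ?_, QuotStack.Hom.isEquivariant g hq'⟩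
        refine Prod.ext ?_ ?_
        · exact congrArg (fun z => BigWitt.map (QuotStack.Hom.total g) z.1) hq
        · exact (congrArg (fun z => QuotStack.Hom.total g z.2) hq).trans (QuotStack.Hom.pt g)⟩
      map_zero' := Subtype.ext (map_zero _)
      map_add' := fun f h => Subtype.ext (map_add _ _ _) }
  map_id _ := rfl
  map_comp _ _ := rfl

/-- The total category of `HtmodGm` over `𝔸¹/𝔾_m`, i.e. the category of pairs (a point of `𝔸¹/𝔾_m`, a
point of `ℍ^t/𝔾_m` over it), maps to the quotient stack of the functor `ℍ^t`. -/
noncomputable def HtmodGm.toQuotStack :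
    (HtmodGm.{u} ⋙ forget AddCommGrpCat.{u}).Elements ⥤ QuotStack Ht.{u} where
  obj p :=
    { base := p.1.base
      P := p.1.P
      pt := HtPts.lift p.2.2
      equivariant := HtPts.lift_isEquivariant p.2.2 }
  map f :=
    { base := f.1.base
      total := f.1.total
      comm := f.1.comm
      coact := f.1.coact
      pt := Subtype.ext (Prod.ext (congrArg Subtype.val f.2) f.1.pt) }

/-- The inverse of `HtmodGm.toQuotStack`. -/
noncomputable def HtmodGm.ofQuotStack :
    QuotStack Ht.{u} ⥤ (HtmodGm.{u} ⋙ forget AddCommGrpCat.{u}).Elements where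
  obj y := ⟨(QuotStack.map Ht.proj).obj y, ⟨y.pt.1.1, y.pt, rfl, y.equivariant⟩⟩
  map f := ⟨(QuotStack.map Ht.proj).map f,
    Subtype.ext (congrArg (fun w => w.1.1) (QuotStack.Hom.pt f))⟩

/-- The total category of `HtmodGm` is the quotient stack of `ℍ^t`, and under this isomorphism the
projection to `𝔸¹/𝔾_m` is the one induced by `ℍ^t → 𝔸¹`. -/
theorem HtmodGm.toQuotStack_ofQuotStack :
    HtmodGm.toQuotStack.{u} ⋙ HtmodGm.ofQuotStack = 𝟭 _ ∧
    HtmodGm.ofQuotStack.{u} ⋙ HtmodGm.toQuotStack = 𝟭 _ ∧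
    HtmodGm.ofQuotStack.{u} ⋙ CategoryOfElements.π _ = QuotStack.map Ht.proj :=
  ⟨rfl, rfl, rfl⟩

/-! Encode a Witt vector `f` as the power series F(Z) = ∏ (1 - f_n Z^n). Witt addition becomes
multiplication of series, and multiplication by [c] becomes Z ↦ cZ. The Rees algebra is free over
ℤ[t] on the elements `b n` = binom(x, n) t^n, so a linear map φ out of it is a sequence of values
φ(`b n`), recorded as the series with coefficients (-1)^n φ(`b n`). For the identity map this series
is (1 - tZ)^x, and its Witt vector `univ` is the universal point; the isomorphism is φ ↦ φ(`univ`)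
(`toWitt`).

The image lies in ℍ^t: at x = k ∈ ℕ the vector `univ` becomes k·[t], for which Frob_n acts as
multiplication by [t]^(n-1), and specialisations at natural numbers detect equality (`frob_univ`).
The map is additive because Vandermonde's comultiplication on `b n` is the multiplication rule for
coefficients of series (`toWitt_mul`), and injective because the `b n` are a basis.

Surjectivity is the substantial point: the linear map defined by the coefficients of F must be
multiplicative. The conceptual reason is Cartier duality: (1 - tp)(1 - tq) = 1 - t(p + q - tpq), so
algebra maps correspond to series with F(p)F(q) = F(p + q - tpq), and this identity has to follow
from the Frobenius relations. For nilpotent p and q, F(p)F(q) is the value at Z = 1 of the series of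
([p] + [q])f. Write [p] + [q] = ∑ V_i[s_i]. The projection formula and the Frobenius relation give
V_i[s_i]·f = V_i([s_i t^(i-1)] f), and V_i does not change the value at Z = 1. Hence F(p)F(q) = ∏
F(s_i t^(i-1)) with s_1 = p + q and the other arguments of higher order (`evalOne_teich_mul_mul`).
Iterating collapses the product to one factor F(z) with z independent of f
(`exists_evalOne_mul_eq`). Testing on f = [t] for a generic, hence cancellable, t shows z = p + q -
tpq. Comparing coefficients gives the product rule `coeff_series_mul_coeff_series`, valid for `univ`
and for `f` with the same constants, and this is multiplicativity.

Finally, [u] rescales Z by u, so equivariance of P → ℍ^t says that the n-th coefficient of F has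
weight n, which is the condition that φ preserves the grading. -/

namespace BigWitt

/-! ### Teichmüller multiplication and Verschiebung in Witt coordinates -/

section Coordinates

variable {A : Type u} {B : Type v} [CommRing A] [CommRing B]

theorem map_coeff (f : A →+* B) (x : BigWitt A) (n : ℕ+) : (map f x).coeff n = f (x.coeff n) := rfl

theorem coe_toPNat' {d : ℕ} (hd : 0 < d) : (d.toPNat' : ℕ) = d := by
  rw [Nat.toPNat'_coe, if_pos hd]

theorem ghost_scale (c : A) (x : BigWitt A) (n : ℕ+) :
    ghost n ⟨fun m => c ^ (m : ℕ) * x.coeff m⟩ = c ^ (n : ℕ) * ghost n x := by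
  rw [ghost, ghost, Finset.mul_sum]
  refine Finset.sum_congr rfl fun d hd => ?_
  rw [mul_pow, coe_toPNat' (Nat.pos_of_mem_divisors hd), ← pow_mul,
    Nat.mul_div_cancel' (Nat.dvd_of_mem_divisors hd)]
  ring

/-- Both sides have ghost components c^n w_n(x). Ghost components determine a vector over a
polynomial ring over ℤ, and every vector is the image of one defined there. -/
theorem teich_mul (c : A) (x : BigWitt A) :
    teich c * x = ⟨fun m => c ^ (m : ℕ) * x.coeff m⟩ := by
  obtain ⟨x, rfl⟩ := exists_lift x
  have h : teichFun (MvPolynomial.X c) * x =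
      ⟨fun m => (MvPolynomial.X c : MvPolynomial A ℤ) ^ (m : ℕ) * x.coeff m⟩ :=
    ghost_injective_mvPolynomial _ _ fun n => by
      rw [ghost_mul, ghost_teichFun, ghost_scale]
  have h2 := congrArg (mapFun (MvPolynomial.eval₂Hom (Int.castRingHom A) id)) h
  rw [mapFun_mul, mapFun_teichFun] at h2
  change teichFun c * _ = _
  simpa [mapFun] using h2

theorem coeff_teich_mul (c : A) (x : BigWitt A) (n : ℕ+) :
    (teich c * x).coeff n = c ^ (n : ℕ) * x.coeff n := by
  rw [teich_mul]

theorem coeff_teich (c : A) (n : ℕ+) : (teich c).coeff n = if n = 1 then c else 0 := rfl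

theorem coeff_zero (n : ℕ+) : (0 : BigWitt A).coeff n = 0 := by
  change (teichFun (0 : A)).coeff n = 0
  simp [teichFun]

theorem teich_zero : teich (0 : A) = 0 := rfl

/-- The Verschiebung maps `V_n`. -/
def verschiebung (n : ℕ+) (x : BigWitt A) : BigWitt A :=
  ⟨fun m => if (n : ℕ) ∣ m then x.coeff ((m : ℕ) / n).toPNat' else 0⟩

theorem coeff_verschiebung_mul (n m : ℕ+) (x : BigWitt A) :
    (verschiebung n x).coeff (n * m) = x.coeff m := by
  simp [verschiebung]

theorem mapFun_verschiebung (f : A →+* B) (n : ℕ+) (x : BigWitt A) :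
    mapFun f (verschiebung n x) = verschiebung n (mapFun f x) := by
  ext m
  simp [verschiebung, mapFun, apply_ite f]

theorem ghost_verschiebung_mul (n m : ℕ+) (x : BigWitt A) :
    ghost (n * m) (verschiebung n x) = n * ghost m x := by
  rw [ghost, ghost, Finset.mul_sum]
  symm
  refine Finset.sum_of_injOn (fun d => (n : ℕ) * d) ?_ ?_ ?_ ?_
  · intro a _ b _ h
    exact Nat.eq_of_mul_eq_mul_left n.pos h
  · intro d hd
    have hd := Nat.dvd_of_mem_divisors hd
    simp only [Finset.mem_coe, Nat.mem_divisors]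
    exact ⟨by rw [PNat.mul_coe]; exact Nat.mul_dvd_mul_left _ hd, PNat.ne_zero _⟩
  · intro d hd hd'
    have hd0 := Nat.pos_of_mem_divisors hd
    have hdm := Nat.dvd_of_mem_divisors hd
    have : ¬ (n : ℕ) ∣ d := by
      rintro ⟨e, rfl⟩
      refine hd' ⟨e, ?_, rfl⟩
      rw [PNat.mul_coe] at hdm
      simp only [Finset.mem_coe, Nat.mem_divisors]
      exact ⟨Nat.dvd_of_mul_dvd_mul_left n.pos hdm, m.ne_zero⟩
    -- The exponent must be positive so that the vanishing coordinate contributes 0 and not 0^0 = 1.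
    have h2 : ((n * m : ℕ+) : ℕ) / d ≠ 0 := (Nat.div_pos (Nat.divisor_le hd) hd0).ne'
    rw [PNat.mul_coe] at h2
    simp [verschiebung, coe_toPNat' hd0, this, h2]
  · intro d hd
    have hd0 := Nat.pos_of_mem_divisors hd
    simp only [verschiebung, coe_toPNat' (Nat.mul_pos n.pos hd0), dvd_mul_right, if_true,
      Nat.mul_div_cancel_left _ n.pos, PNat.mul_coe, Nat.mul_div_mul_left _ _ n.pos]
    push_cast
    ring

theorem ghost_verschiebung_of_not_dvd (n m : ℕ+) (h : ¬ (n : ℕ) ∣ m) (x : BigWitt A) :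
    ghost m (verschiebung n x) = 0 := by
  refine Finset.sum_eq_zero fun d hd => ?_
  have hd0 := Nat.pos_of_mem_divisors hd
  have h2 : (m : ℕ) / d ≠ 0 := (Nat.div_pos (Nat.divisor_le hd) hd0).ne'
  have h3 : ¬ (n : ℕ) ∣ d := fun h' => h (h'.trans (Nat.dvd_of_mem_divisors hd))
  simp [verschiebung, coe_toPNat' hd0, h3, h2]

/-- Projection formula. On ghost components, both sides are n·w_k(x)·w_{nk}(y) at index nk and 0 at
indices not divisible by n. -/
theorem verschiebung_mul (n : ℕ+) (x y : BigWitt A) :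
    verschiebung n x * y = verschiebung n (x * frob n y) := by
  obtain ⟨x, rfl⟩ := exists_lift x
  obtain ⟨y, rfl⟩ := exists_lift y
  change _ = verschiebung n (_ * frobFun n _)
  rw [← mapFun_frobFun, ← mapFun_mul, ← mapFun_verschiebung, ← mapFun_verschiebung, ← mapFun_mul]
  refine congrArg _ (ghost_injective_mvPolynomial _ _ fun m => ?_)
  by_cases h : (n : ℕ) ∣ m
  · obtain ⟨k, rfl⟩ := PNat.dvd_iff.mpr h
    simp only [ghost_mul, ghost_verschiebung_mul, ghost_frobFun, mul_assoc]
  · simp only [ghost_mul, ghost_verschiebung_of_not_dvd n m h, zero_mul]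

end Coordinates

/-! ### Witt vectors as power series with constant term 1 -/

section Series

/-- The finite product `∏_{n ≤ M} (1 - y_n Z^n)`. -/
noncomputable def partialProd {A : Type u} [CommRing A] (M : ℕ) (y : BigWitt A) : PowerSeries A :=
  ∏ i ∈ Finset.range M, (1 - PowerSeries.C (y.coeff i.succPNat) * PowerSeries.X ^ (i + 1))

/-- The power series `∏_n (1 - y_n Z^n)` attached to a Witt vector. -/
noncomputable def series {A : Type u} [CommRing A] (y : BigWitt A) : PowerSeries A :=
  PowerSeries.mk fun m => PowerSeries.coeff m (partialProd m y)

variable {A : Type u} {B : Type v} [CommRing A] [CommRing B]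

theorem partialProd_succ (M : ℕ) (y : BigWitt A) : partialProd (M + 1) y =
    partialProd M y * (1 - PowerSeries.C (y.coeff M.succPNat) * PowerSeries.X ^ (M + 1)) :=
  Finset.prod_range_succ _ _

theorem coeff_partialProd_succ (M m : ℕ) (y : BigWitt A) :
    PowerSeries.coeff m (partialProd (M + 1) y) = PowerSeries.coeff m (partialProd M y) -
      if M + 1 ≤ m then y.coeff M.succPNat * PowerSeries.coeff (m - (M + 1)) (partialProd M y)
      else 0 := by
  rw [partialProd_succ, mul_sub, mul_one, map_sub, mul_left_comm, PowerSeries.coeff_C_mul,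
    PowerSeries.coeff_mul_X_pow', mul_ite, mul_zero]

/-- Factors of index beyond m do not touch degree m, so coefficients of the finite products
stabilise. All statements about the infinite product are reduced to finite ones through this. -/
theorem coeff_partialProd {M m : ℕ} (h : m ≤ M) (y : BigWitt A) :
    PowerSeries.coeff m (partialProd M y) = PowerSeries.coeff m (series y) := by
  rw [series, PowerSeries.coeff_mk]
  induction M, h using Nat.le_induction with
  | base => rfl
  | succ M hM ih => rw [coeff_partialProd_succ, if_neg (by omega), sub_zero, ih]

theorem map_partialProd (f : A →+* B) (M : ℕ) (y : BigWitt A) :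
    PowerSeries.map f (partialProd M y) = partialProd M (map f y) := by
  simp [partialProd, map_prod, map_coeff]

theorem map_series (f : A →+* B) (y : BigWitt A) :
    PowerSeries.map f (series y) = series (map f y) := by
  ext m
  rw [PowerSeries.coeff_map, ← coeff_partialProd le_rfl, ← coeff_partialProd le_rfl,
    ← map_partialProd, PowerSeries.coeff_map]

theorem coeff_partialProd_zero (M : ℕ) (y : BigWitt A) :
    PowerSeries.coeff 0 (partialProd M y) = 1 := by
  induction M with
  | zero => simp [partialProd]
  | succ M ih => rw [coeff_partialProd_succ, if_neg (by omega), sub_zero, ih]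

theorem coeff_zero_series (y : BigWitt A) : PowerSeries.coeff 0 (series y) = 1 := by
  rw [← coeff_partialProd le_rfl, coeff_partialProd_zero]

/-- The coordinate of index m + 1 enters degree m + 1 linearly with coefficient -1, and everything
else there depends on earlier coordinates. This triangularity makes the coordinates recoverable from
the series and drives both `series_injective` and `ofSeries`. -/
theorem coeff_succ_series (m : ℕ) (y : BigWitt A) : PowerSeries.coeff (m + 1) (series y) =
    PowerSeries.coeff (m + 1) (partialProd m y) - y.coeff m.succPNat := by
  rw [← coeff_partialProd le_rfl, coeff_partialProd_succ, if_pos le_rfl, Nat.sub_self,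
    coeff_partialProd_zero, mul_one]

theorem partialProd_congr {M : ℕ} {x y : BigWitt A}
    (h : ∀ i < M, x.coeff i.succPNat = y.coeff i.succPNat) : partialProd M x = partialProd M y :=
  Finset.prod_congr rfl fun i hi => by rw [h i (Finset.mem_range.mp hi)]

theorem series_injective : Function.Injective (series : BigWitt A → PowerSeries A) := by
  intro x y h
  have key : ∀ m : ℕ, x.coeff m.succPNat = y.coeff m.succPNat := by
    intro m
    induction m using Nat.strong_induction_on with
    | _ m ih =>
      have h1 := congrArg (PowerSeries.coeff (m + 1)) h
      rwa [coeff_succ_series, coeff_succ_series, partialProd_congr ih, sub_right_inj] at h1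
  ext n
  rw [← PNat.succPNat_natPred n]
  exact key _

/-- The Witt coordinates (shifted by one) of a power series with constant coefficient `1`. -/
noncomputable def ofSeriesCoeff (g : PowerSeries A) (m : ℕ) : A :=
  PowerSeries.coeff (m + 1) (∏ i : Fin m,
    (1 - PowerSeries.C (ofSeriesCoeff g i) * PowerSeries.X ^ ((i : ℕ) + 1))) -
    PowerSeries.coeff (m + 1) g

/-- The Witt vector of a power series with constant coefficient `1`. -/
noncomputable def ofSeries (g : PowerSeries A) : BigWitt A :=
  ⟨fun n => ofSeriesCoeff g n.natPred⟩

theorem series_ofSeries (g : PowerSeries A) (hg : PowerSeries.coeff 0 g = 1) :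
    series (ofSeries g) = g := by
  ext m
  cases m with
  | zero => rw [coeff_zero_series, hg]
  | succ m =>
    rw [coeff_succ_series]
    have h : (ofSeries g).coeff m.succPNat =
        PowerSeries.coeff (m + 1) (partialProd m (ofSeries g)) - PowerSeries.coeff (m + 1) g := by
      have : (ofSeries g).coeff m.succPNat = ofSeriesCoeff g m := by simp [ofSeries]
      rw [this, ofSeriesCoeff, partialProd, Finset.prod_range]
      simp [ofSeries]
    rw [h, sub_sub_cancel]

/-- In each factor, c^n y_n Z^n = y_n (cZ)^n. -/
theorem series_teich_mul (c : A) (y : BigWitt A) :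
    series (teich c * y) = PowerSeries.rescale c (series y) := by
  have h : ∀ M, partialProd M (teich c * y) = PowerSeries.rescale c (partialProd M y) := by
    intro M
    simp only [partialProd, map_prod, map_sub, map_one, map_mul, map_pow, PowerSeries.rescale_X,
      coeff_teich_mul, Nat.succPNat_coe, Nat.succ_eq_add_one]
    refine Finset.prod_congr rfl fun i _ => ?_
    have : PowerSeries.rescale c (PowerSeries.C (y.coeff i.succPNat)) =
        PowerSeries.C (y.coeff i.succPNat) := by
      ext n; rw [PowerSeries.coeff_rescale, PowerSeries.coeff_C]; split_ifs with h <;> simp [h]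
    rw [this]
    ring
  ext m
  rw [← coeff_partialProd le_rfl, h, PowerSeries.coeff_rescale, PowerSeries.coeff_rescale,
    coeff_partialProd le_rfl]

/-! ### Logarithmic derivatives, and addition as multiplication of series -/

/-- The series `∑_{k ≥ 1} n · c^k Z^{nk}`, minus the logarithmic derivative of `1 - c Z^n`. -/
noncomputable def logDerivFactor (n : ℕ) (c : A) : PowerSeries A :=
  PowerSeries.mk fun k => if k ≠ 0 ∧ n ∣ k then (n : A) * c ^ (k / n) else 0

theorem X_mul_derivative_factor (n : ℕ) (hn : 0 < n) (c : A) :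
    PowerSeries.X * PowerSeries.derivative A (1 - PowerSeries.C c * PowerSeries.X ^ n) =
      -(logDerivFactor n c * (1 - PowerSeries.C c * PowerSeries.X ^ n)) := by
  have h1 : PowerSeries.X * PowerSeries.derivative A (1 - PowerSeries.C c * PowerSeries.X ^ n) =
      -((n : PowerSeries A) * PowerSeries.C c * PowerSeries.X ^ n) := by
    obtain ⟨m, rfl⟩ := Nat.exists_eq_succ_of_ne_zero hn.ne'
    simp [Derivation.leibniz_pow, PowerSeries.derivative_C, PowerSeries.derivative_X]
    ring
  rw [h1, neg_inj, mul_sub, mul_one, mul_left_comm]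
  ext k
  rw [← map_natCast (PowerSeries.C (R := A)), ← map_mul, PowerSeries.coeff_C_mul, map_sub,
    PowerSeries.coeff_C_mul,
    PowerSeries.coeff_mul_X_pow', PowerSeries.coeff_X_pow, logDerivFactor, PowerSeries.coeff_mk,
    PowerSeries.coeff_mk]
  rcases Nat.lt_or_ge k n with hk | hk
  · have : ¬ (k ≠ 0 ∧ n ∣ k) := fun h => absurd (Nat.le_of_dvd (Nat.pos_of_ne_zero h.1) h.2) (by omega)
    rw [if_neg (by omega), if_neg this, if_neg (by omega)]
    simp
  · obtain ⟨l, rfl⟩ := Nat.exists_eq_add_of_le hk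
    rw [if_pos hk, Nat.add_sub_cancel_left]
    by_cases hd : n ∣ l
    · obtain ⟨j, rfl⟩ := hd
      rcases Nat.eq_zero_or_pos j with rfl | hj
      · simp [hn.ne', Nat.div_self hn]
      · have h2 : n * j ≠ 0 := (Nat.mul_pos hn hj).ne'
        have h3 : n + n * j ≠ n := by omega
        have h4 : (n + n * j) / n = j + 1 := by
          rw [add_comm, ← Nat.mul_succ, Nat.mul_div_cancel_left _ hn]
        rw [if_neg h3, if_pos ⟨by omega, by simp⟩, if_pos ⟨h2, by simp⟩, h4,
          Nat.mul_div_cancel_left _ hn]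
        ring
    · have h3 : n + l ≠ n := fun h => hd (by simp [show l = 0 by omega])
      rw [if_neg h3, if_neg (fun h => hd ((Nat.dvd_add_right (dvd_refl n)).mp h.2)),
        if_neg (fun h => hd h.2)]
      simp

theorem X_mul_derivative_partialProd (M : ℕ) (y : BigWitt A) :
    PowerSeries.X * PowerSeries.derivative A (partialProd M y) =
      -((∑ i ∈ Finset.range M, logDerivFactor (i + 1) (y.coeff i.succPNat)) * partialProd M y) := by
  induction M with
  | zero => simp [partialProd]
  | succ M ih =>
    rw [partialProd_succ, Derivation.leibniz, Finset.sum_range_succ, smul_eq_mul, smul_eq_mul,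
      mul_add, mul_left_comm, X_mul_derivative_factor (M + 1) M.succ_pos, mul_left_comm PowerSeries.X, ih]
    ring

/-- The generating series of the ghost components. -/
noncomputable def ghostSeries (y : BigWitt A) : PowerSeries A :=
  PowerSeries.mk fun k => if 0 < k then ghost k.toPNat' y else 0

/-- The factor of index d contributes d·y_d^(k/d) in degree k exactly when d divides k; these are
the terms of the k-th ghost component. The summation index is d - 1. -/
theorem coeff_sum_logDerivFactor {M k : ℕ} (h : k ≤ M) (y : BigWitt A) :
    PowerSeries.coeff k (∑ i ∈ Finset.range M, logDerivFactor (i + 1) (y.coeff i.succPNat)) =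
      PowerSeries.coeff k (ghostSeries y) := by
  simp only [map_sum, logDerivFactor, ghostSeries, PowerSeries.coeff_mk]
  split_ifs with hk
  · simp only [ne_eq, hk.ne', not_false_eq_true, true_and]
    rw [← Finset.sum_filter, ghost, coe_toPNat' hk]
    symm
    refine Finset.sum_of_injOn Nat.pred ?_ ?_ ?_ ?_
    · intro a ha b hb hab
      have ha := Nat.pos_of_mem_divisors ha
      have hb := Nat.pos_of_mem_divisors hb
      simp only [Nat.pred_eq_sub_one] at hab
      omega
    · intro d hd
      have hd0 := Nat.pos_of_mem_divisors hd
      have hd1 := Nat.divisor_le hd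
      simp only [Finset.coe_filter, Set.mem_ofPred_eq, Finset.mem_range, Nat.pred_eq_sub_one]
      refine ⟨by omega, ?_⟩
      rw [Nat.sub_add_cancel hd0]
      exact Nat.dvd_of_mem_divisors hd
    · intro i hi hi'
      exfalso
      simp only [Finset.mem_filter, Finset.mem_range] at hi
      refine hi' ⟨i + 1, ?_, rfl⟩
      simp only [Finset.mem_coe, Nat.mem_divisors]
      exact ⟨hi.2, hk.ne'⟩
    · intro d hd
      have hd0 := Nat.pos_of_mem_divisors hd
      obtain ⟨e, rfl⟩ := Nat.exists_eq_succ_of_ne_zero hd0.ne'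
      rfl
  · have : k = 0 := by omega
    subst this
    simp

theorem X_mul_derivative_series (y : BigWitt A) :
    PowerSeries.X * PowerSeries.derivative A (series y) = -(ghostSeries y * series y) := by
  ext k
  -- Degree k sees only the first k factors, so the formula for the finite product suffices.
  have h := congrArg (PowerSeries.coeff k) (X_mul_derivative_partialProd k y)
  have h1 : PowerSeries.coeff k (PowerSeries.X * PowerSeries.derivative A (series y)) =
      PowerSeries.coeff k (PowerSeries.X * PowerSeries.derivative A (partialProd k y)) := by
    cases k with
    | zero => simp
    | succ k =>
      rw [PowerSeries.coeff_succ_X_mul, PowerSeries.coeff_succ_X_mul, PowerSeries.coeff_derivative,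
        PowerSeries.coeff_derivative, coeff_partialProd le_rfl]
  rw [h1, h, map_neg, map_neg, PowerSeries.coeff_mul, PowerSeries.coeff_mul]
  refine congrArg _ (Finset.sum_congr rfl fun q hq => ?_)
  have := Finset.HasAntidiagonal.mem_antidiagonal.mp hq
  rw [coeff_sum_logDerivFactor (by omega), coeff_partialProd (by omega)]

theorem ghostSeries_add (x y : BigWitt A) :
    ghostSeries (x + y) = ghostSeries x + ghostSeries y := by
  ext k
  simp only [ghostSeries, PowerSeries.coeff_mk, map_add, ghost_add]
  split_ifs <;> simp

/-- The equation Z·e' = -w·e is linear, and since w has no constant term it expresses (k +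
1)·e_{k+1} through e_0, …, e_k. Torsion-freeness then forces a solution with e_0 = 0 to vanish. -/
theorem eq_of_X_mul_derivative_eq (hA : ∀ (n : ℕ) (a : A), n ≠ 0 → (n : A) * a = 0 → a = 0)
    (w g h : PowerSeries A) (hw : PowerSeries.coeff 0 w = 0)
    (h0 : PowerSeries.coeff 0 g = PowerSeries.coeff 0 h)
    (hg : PowerSeries.X * PowerSeries.derivative A g = -(w * g))
    (hh : PowerSeries.X * PowerSeries.derivative A h = -(w * h)) : g = h := by
  rw [← sub_eq_zero]
  set e := g - h with he
  have heq : PowerSeries.X * PowerSeries.derivative A e = -(w * e) := by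
    rw [he, map_sub, mul_sub, hg, hh]; ring
  ext k
  induction k using Nat.strong_induction_on with
  | _ k ih =>
    cases k with
    | zero => rw [he, map_sub, h0, sub_self, map_zero]
    | succ k =>
      have h1 := congrArg (PowerSeries.coeff (k + 1)) heq
      rw [PowerSeries.coeff_succ_X_mul, PowerSeries.coeff_derivative, map_neg,
        PowerSeries.coeff_mul, Finset.sum_eq_zero, neg_zero, mul_comm] at h1
      · exact hA (k + 1) _ k.succ_ne_zero (by exact_mod_cast h1)
      · intro q hq
        have hq' := Finset.HasAntidiagonal.mem_antidiagonal.mp hq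
        rcases Nat.eq_zero_or_pos q.1 with hq1 | hq1
        · rw [hq1, hw, zero_mul]
        · rw [ih q.2 (by omega), map_zero, mul_zero]

/-- Ghost components form minus the logarithmic derivative of the series and are additive, so both
sides solve the same differential equation with the same constant term. Lifting to a polynomial ring
over ℤ supplies the torsion-freeness needed for uniqueness. -/
theorem series_add (x y : BigWitt A) : series (x + y) = series x * series y := by
  obtain ⟨x, rfl⟩ := exists_lift x
  obtain ⟨y, rfl⟩ := exists_lift y
  rw [← mapFun_add]
  change series (map _ _) = series (map _ _) * series (map _ _)
  rw [← map_series, ← map_series, ← map_series, ← map_mul]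
  refine congrArg _ (eq_of_X_mul_derivative_eq
    (fun _ _ hn ha => (mul_eq_zero.mp ha).resolve_left (Nat.cast_ne_zero.mpr hn))
    (ghostSeries (x + y)) _ _ (by simp [ghostSeries]) ?_ (X_mul_derivative_series _) ?_)
  · rw [coeff_zero_series, PowerSeries.coeff_zero_eq_constantCoeff_apply, map_mul,
      ← PowerSeries.coeff_zero_eq_constantCoeff_apply,
      ← PowerSeries.coeff_zero_eq_constantCoeff_apply, coeff_zero_series, coeff_zero_series, mul_one]
  · rw [Derivation.leibniz, smul_eq_mul, smul_eq_mul, mul_add, mul_left_comm,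
      X_mul_derivative_series, mul_left_comm, X_mul_derivative_series, ghostSeries_add]
    ring

theorem series_zero : series (0 : BigWitt A) = 1 := by
  ext m
  rw [← coeff_partialProd le_rfl]
  simp [partialProd, coeff_zero]

theorem series_sum {ι : Type*} (s : Finset ι) (y : ι → BigWitt A) :
    series (∑ i ∈ s, y i) = ∏ i ∈ s, series (y i) := by
  classical
  induction s using Finset.induction_on with
  | empty => rw [Finset.sum_empty, Finset.prod_empty, series_zero]
  | insert a s ha ih => rw [Finset.sum_insert ha, Finset.prod_insert ha, series_add, ih]

theorem coeff_partialProd_of_coeff_eq_zero {M K : ℕ} (hK : K ≤ M) {y : BigWitt A}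
    (h : ∀ n : ℕ+, K < n → y.coeff n = 0) : partialProd M y = partialProd K y := by
  induction M, hK using Nat.le_induction with
  | base => rfl
  | succ M hM ih =>
    rw [partialProd_succ, ih, h _ (by simpa using Nat.lt_succ_of_le hM)]
    simp

theorem series_eq_partialProd {K : ℕ} {y : BigWitt A} (h : ∀ n : ℕ+, K < n → y.coeff n = 0) :
    series y = partialProd K y := by
  ext m
  rw [← coeff_partialProd (le_max_left m K), coeff_partialProd_of_coeff_eq_zero (le_max_right m K) h]

theorem series_verschiebung_teich (i : ℕ) (c : A) :
    series (verschiebung i.succPNat (teich c)) =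
      1 - PowerSeries.C c * PowerSeries.X ^ (i + 1) := by
  have h : ∀ n : ℕ+, (verschiebung i.succPNat (teich c)).coeff n =
      if n = i.succPNat then c else 0 := by
    intro n
    simp only [verschiebung, coeff_teich]
    by_cases hn : (i.succPNat : ℕ) ∣ n
    · obtain ⟨k, rfl⟩ := PNat.dvd_iff.mpr hn
      simp
    · rw [if_neg hn, if_neg]
      rintro rfl
      exact hn dvd_rfl
  rw [series_eq_partialProd (K := i + 1), partialProd_succ, h, if_pos rfl]
  · rw [partialProd, Finset.prod_eq_one, one_mul]
    intro j hj
    have := Finset.mem_range.mp hj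
    rw [h, if_neg]
    · simp
    · intro h'
      have := Nat.succPNat_injective h'
      omega
  · intro n hn
    rw [h, if_neg]
    rintro rfl
    simp at hn

/-- The vector V_n[c] has series 1 - cZ^n, so this sum is the factorisation of the series of `y`
read additively. -/
theorem eq_sum_verschiebung_teich {K : ℕ} {y : BigWitt A} (h : ∀ n : ℕ+, K < n → y.coeff n = 0) :
    y = ∑ i ∈ Finset.range K, verschiebung i.succPNat (teich (y.coeff i.succPNat)) := by
  apply series_injective
  rw [series_sum, series_eq_partialProd h]
  exact Finset.prod_congr rfl fun i _ => (series_verschiebung_teich _ _).symm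

end Series

end BigWitt

namespace BigWitt

/-! ### Values at nilpotent arguments and the universal group law -/

section Evaluation

variable {D : Type u} [CommRing D]

/-- The value at `Z = 1` of `∏_{n ≤ K} (1 - y_n Z^n)`. -/
def evalOne (K : ℕ) (y : BigWitt D) : D :=
  ∏ i ∈ Finset.range K, (1 - y.coeff i.succPNat)

/-- The Witt vectors whose `n`-th coordinate lies in `N ^ n`. -/
def IsAdapted (N : Ideal D) (y : BigWitt D) : Prop :=
  ∀ n : ℕ+, y.coeff n ∈ N ^ (n : ℕ)

variable {N : Ideal D}

theorem isAdapted_zero : IsAdapted N (0 : BigWitt D) := fun n => by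
  rw [coeff_zero]; exact zero_mem _

/-- A vector `z` is adapted exactly when [X]·z, with coordinates X^n z_n, has all its coordinates in
the Rees algebra ⊕ N^n X^n. That algebra is a subring of D[X], so its Witt vectors are closed under
addition. -/
theorem IsAdapted.add {x y : BigWitt D} (hx : IsAdapted N x) (hy : IsAdapted N y) :
    IsAdapted N (x + y) := by
  have key : ∀ {z : BigWitt D}, IsAdapted N z → ∃ w : BigWitt (reesAlgebra N),
      map (reesAlgebra N).val.toRingHom w = teich X * map C z := by
    intro z hz
    refine ⟨⟨fun n => ⟨X ^ (n : ℕ) * C (z.coeff n), ?_⟩⟩, ?_⟩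
    · rw [mem_reesAlgebra_iff]
      intro i
      rw [mul_comm, coeff_C_mul_X_pow]
      split_ifs with h
      · rw [h]; exact hz n
      · exact zero_mem _
    · ext1; funext n
      rw [coeff_teich_mul]; rfl
  obtain ⟨v, hv⟩ := key hx
  obtain ⟨w, hw⟩ := key hy
  intro n
  have h : (map (reesAlgebra N).val.toRingHom (v + w)).coeff n =
      X ^ (n : ℕ) * C ((x + y).coeff n) := by
    rw [map_add, hv, hw, ← mul_add, ← map_add, coeff_teich_mul, map_coeff]
  have h2 : ((v + w).coeff n : D[X]) ∈ reesAlgebra N := ((v + w).coeff n).2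
  have h3 : ((v + w).coeff n : D[X]) = X ^ (n : ℕ) * C ((x + y).coeff n) := h
  rw [h3, mem_reesAlgebra_iff] at h2
  have := h2 n
  rwa [mul_comm, coeff_C_mul_X_pow, if_pos rfl] at this

theorem isAdapted_sum {ι : Type*} (s : Finset ι) (y : ι → BigWitt D)
    (hy : ∀ i ∈ s, IsAdapted N (y i)) : IsAdapted N (∑ i ∈ s, y i) := by
  classical
  induction s using Finset.induction_on with
  | empty => rw [Finset.sum_empty]; exact isAdapted_zero
  | insert a s ha ih =>
    rw [Finset.sum_insert ha]
    exact (hy a (Finset.mem_insert_self _ _)).add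
      (ih fun i hi => hy i (Finset.mem_insert_of_mem hi))

theorem isAdapted_teich_mul {c : D} (hc : c ∈ N) (y : BigWitt D) : IsAdapted N (teich c * y) :=
  fun n => by
    rw [coeff_teich_mul]
    exact Ideal.mul_mem_right _ _ (Ideal.pow_mem_pow hc _)

theorem isAdapted_verschiebung {i : ℕ+} {c : D} (hc : c ∈ N ^ (i : ℕ)) (y : BigWitt D) :
    IsAdapted N (verschiebung i (teich c * y)) := fun n => by
  by_cases hn : (i : ℕ) ∣ n
  · obtain ⟨k, rfl⟩ := PNat.dvd_iff.mpr hn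
    rw [coeff_verschiebung_mul, coeff_teich_mul, PNat.mul_coe, pow_mul]
    exact Ideal.mul_mem_right _ _ (Ideal.pow_mem_pow hc _)
  · simp [verschiebung, hn]

theorem eq_zero_of_mem_pow {K : ℕ} (hN : N ^ K = ⊥) {n : ℕ} (hn : K ≤ n) {c : D}
    (hc : c ∈ N ^ n) : c = 0 := by
  have := Ideal.pow_le_pow_right hn hc
  rwa [hN, Ideal.mem_bot] at this

theorem IsAdapted.coeff_eq_zero {K : ℕ} (hN : N ^ K = ⊥) {y : BigWitt D} (hy : IsAdapted N y)
    (n : ℕ+) (hn : K < n) : y.coeff n = 0 :=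
  eq_zero_of_mem_pow hN hn.le (hy n)

/-- The polynomial `∏_{n ≤ K} (1 - y_n Z^n)`. -/
noncomputable def partialPoly (K : ℕ) (y : BigWitt D) : D[X] :=
  ∏ i ∈ Finset.range K, (1 - C (y.coeff i.succPNat) * X ^ (i + 1))

theorem coe_partialPoly (K : ℕ) (y : BigWitt D) :
    (partialPoly K y : PowerSeries D) = partialProd K y := by
  rw [partialPoly, partialProd, ← Polynomial.coeToPowerSeries.ringHom_apply, map_prod]
  simp

theorem eval_one_partialPoly (K : ℕ) (y : BigWitt D) : (partialPoly K y).eval 1 = evalOne K y := by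
  simp [partialPoly, evalOne, eval_prod]

/-- Adapted vectors have no coordinates beyond `K` when N^K = 0. The three series are therefore
polynomials, and `series_add` may be evaluated at Z = 1. -/
theorem evalOne_add {K : ℕ} (hN : N ^ K = ⊥) {x y : BigWitt D} (hx : IsAdapted N x)
    (hy : IsAdapted N y) : evalOne K (x + y) = evalOne K x * evalOne K y := by
  rw [← eval_one_partialPoly, ← eval_one_partialPoly, ← eval_one_partialPoly, ← eval_mul]
  refine congrArg _ (Polynomial.coe_injective D ?_)
  rw [Polynomial.coe_mul, coe_partialPoly, coe_partialPoly, coe_partialPoly,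
    ← series_eq_partialProd ((hx.add hy).coeff_eq_zero hN),
    ← series_eq_partialProd (hx.coeff_eq_zero hN),
    ← series_eq_partialProd (hy.coeff_eq_zero hN), series_add]

theorem evalOne_sum {K : ℕ} (hN : N ^ K = ⊥) {ι : Type*} (s : Finset ι) (y : ι → BigWitt D)
    (hy : ∀ i ∈ s, IsAdapted N (y i)) : evalOne K (∑ i ∈ s, y i) = ∏ i ∈ s, evalOne K (y i) := by
  classical
  induction s using Finset.induction_on with
  | empty => simp [evalOne, coeff_zero]
  | insert a s ha ih =>
    have h := fun i hi => hy i (Finset.mem_insert_of_mem hi)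
    rw [Finset.sum_insert ha, Finset.prod_insert ha,
      evalOne_add hN (hy a (Finset.mem_insert_self _ _)) (isAdapted_sum _ _ h), ih h]

theorem evalOne_of_le {K M : ℕ} (hN : N ^ K = ⊥) (hK : K ≤ M) {y : BigWitt D}
    (hy : IsAdapted N y) : evalOne M y = evalOne K y := by
  symm
  refine Finset.prod_subset (Finset.range_mono hK) fun i _ hi => ?_
  rw [hy.coeff_eq_zero hN, sub_zero]
  simpa using Nat.lt_succ_of_le (not_lt.mp (fun h => hi (Finset.mem_range.mpr h)))

/-- Verschiebung of index i + 1 replaces Z by Z^(i+1), which is invisible at Z = 1. The condition on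
`c` makes the shifted vector adapted, so its product may be prolonged to (i + 1)K factors; those of
index divisible by i + 1 match the factors on the right and the others are 1. -/
theorem evalOne_verschiebung {K : ℕ} (hN : N ^ K = ⊥) {i : ℕ} {c : D} (hc : c ∈ N ^ (i + 1))
    (y : BigWitt D) :
    evalOne K (verschiebung i.succPNat (teich c * y)) = evalOne K (teich c * y) := by
  have h := isAdapted_verschiebung (i := i.succPNat) (by simpa using hc) y
  rw [← evalOne_of_le hN (Nat.le_mul_of_pos_left K i.succ_pos) h]
  symm
  refine Finset.prod_of_injOn (fun k => (i + 1) * (k + 1) - 1) ?_ ?_ ?_ ?_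
  · intro a _ b _ hab
    have ha : 0 < (i + 1) * (a + 1) := by positivity
    have hb : 0 < (i + 1) * (b + 1) := by positivity
    simp only at hab
    have : (i + 1) * (a + 1) = (i + 1) * (b + 1) := by omega
    simpa using Nat.eq_of_mul_eq_mul_left i.succ_pos this
  · intro k hk
    have hk : k + 1 ≤ K := Finset.mem_range.mp hk
    have h1 := Nat.mul_le_mul_left (i + 1) hk
    have ha : 0 < (i + 1) * (k + 1) := by positivity
    simp only [Finset.coe_range, Set.mem_Iio, Nat.succ_eq_add_one]
    omega
  · intro j hj hj'
    have : ¬ (i + 1) ∣ (j + 1) := by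
      rintro ⟨k, hk⟩
      have hk0 : k ≠ 0 := by rintro rfl; simp at hk
      obtain ⟨l, rfl⟩ := Nat.exists_eq_succ_of_ne_zero hk0
      refine hj' ⟨l, ?_, ?_⟩
      · have hj : j + 1 ≤ (i + 1) * K := Finset.mem_range.mp hj
        rw [hk] at hj
        simpa using Nat.le_of_mul_le_mul_left hj i.succ_pos
      · simp only
        rw [← Nat.succ_eq_add_one l, ← hk, Nat.add_sub_cancel]
    simp [verschiebung, this]
  · intro k _
    have ha : 0 < (i + 1) * (k + 1) := by positivity
    have : ((i + 1) * (k + 1) - 1).succPNat = i.succPNat * k.succPNat := by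
      apply PNat.eq
      simp only [Nat.succPNat_coe, PNat.mul_coe, Nat.succ_eq_add_one]
      omega
    rw [this, coeff_verschiebung_mul]

/-- The value at Z = 1 after multiplication by [p] is the value at Z = p. This turns products over
Witt coordinates into the series expansion F(p), truncated because p^K = 0. -/
theorem evalOne_teich_mul_eq_sum {K : ℕ} (hN : N ^ K = ⊥) {p : D} (hp : p ∈ N) (y : BigWitt D) :
    evalOne K (teich p * y) =
      ∑ i ∈ Finset.range K, PowerSeries.coeff i (series y) * p ^ i := by
  have h1 : evalOne K (teich p * y) = (partialPoly K y).eval p := by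
    rw [partialPoly, evalOne, eval_prod]
    refine Finset.prod_congr rfl fun i _ => ?_
    rw [coeff_teich_mul, mul_comm (p ^ _)]
    simp
  -- The truncated product agrees with the series only up to degree `K` and may have larger degree;
  -- its terms of degree at least `K` die because p^i does.
  set M := max K ((partialPoly K y).natDegree + 1)
  rw [h1, eval_eq_sum_range' (lt_of_lt_of_le (Nat.lt_succ_self _) (le_max_right K _))]
  symm
  rw [Finset.sum_congr rfl (g := fun i => (partialPoly K y).coeff i * p ^ i)]
  · refine Finset.sum_subset (Finset.range_mono (le_max_left _ _)) fun i _ hi => ?_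
    rw [eq_zero_of_mem_pow hN (not_lt.mp fun h => hi (Finset.mem_range.mpr h))
      (Ideal.pow_mem_pow hp i), mul_zero]
  · intro i hi
    rw [← coeff_partialProd (Finset.mem_range.mp hi).le, ← coe_partialPoly, Polynomial.coeff_coe]

theorem coeff_one_add (x y : BigWitt D) : (x + y).coeff 1 = x.coeff 1 + y.coeff 1 := by
  have h : ∀ z : BigWitt D, ghost 1 z = z.coeff 1 := fun z => by
    simp [ghost, show Nat.toPNat' 1 = 1 from rfl]
  rw [← h, ghost_add, h, h]

theorem series_teich (c : D) : series (teich c) = 1 - PowerSeries.C c * PowerSeries.X := by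
  rw [series_eq_partialProd (K := 1)]
  · simp [partialProd, coeff_teich, show Nat.succPNat 0 = 1 from rfl]
  · intro n hn
    rw [coeff_teich, if_neg]
    rintro rfl
    simp at hn

theorem teich_add_of_mul_eq_zero {p q : D} (h : p * q = 0) :
    teich p + teich q = teich (p + q) := by
  apply series_injective
  have h2 : (PowerSeries.C p * PowerSeries.C q : PowerSeries D) = 0 := by rw [← map_mul, h, map_zero]
  rw [series_add, series_teich, series_teich, series_teich, map_add]
  linear_combination PowerSeries.X ^ 2 * h2

/-- Modulo `I` the product pq vanishes, so (1 - pZ)(1 - qZ) = 1 - (p + q)Z and [p] + [q] is again a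
Teichmüller vector. -/
theorem coeff_teich_add_mem {I : Ideal D} {p q : D} (h : p * q ∈ I) (n : ℕ+) (hn : n ≠ 1) :
    (teich p + teich q).coeff n ∈ I := by
  rw [← Ideal.Quotient.eq_zero_iff_mem, ← map_coeff, map_add, map_teich, map_teich,
    teich_add_of_mul_eq_zero, coeff_teich, if_neg hn]
  rw [← map_mul, Ideal.Quotient.eq_zero_iff_mem]
  exact h

/-- Decompose [p] + [q] as ∑ V_n[s_n] and multiply by `f`. The projection formula produces Frob_n f,
the defining relation of ℍ^t turns it into [t]^(n-1) f, and evaluation at 1 then forgets V_n. This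
is the only place where the Frobenius relations enter the group law. -/
theorem evalOne_teich_mul_mul {K : ℕ} (hN : N ^ K = ⊥) (t : D) {f : BigWitt D}
    (hf : ∀ n : ℕ+, frob n f = teich t ^ ((n : ℕ) - 1) * f) {p q : D} (hp : p ∈ N) (hq : q ∈ N) :
    evalOne K (teich p * f) * evalOne K (teich q * f) = ∏ i ∈ Finset.range K,
      evalOne K (teich ((teich p + teich q).coeff i.succPNat * t ^ i) * f) := by
  have had : ∀ {c : D}, c ∈ N → IsAdapted N (teich c) := fun hc => by
    rw [← mul_one (teich _)]; exact isAdapted_teich_mul hc 1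
  have hs : IsAdapted N (teich p + teich q) := (had hp).add (had hq)
  have hc : ∀ i : ℕ, (teich p + teich q).coeff i.succPNat * t ^ i ∈ N ^ (i + 1) := fun i =>
    Ideal.mul_mem_right _ _ (by simpa using hs i.succPNat)
  rw [← evalOne_add hN (isAdapted_teich_mul hp f) (isAdapted_teich_mul hq f), ← add_mul]
  conv_lhs => rw [eq_sum_verschiebung_teich (hs.coeff_eq_zero hN)]
  have h : ∀ i : ℕ, verschiebung i.succPNat (teich ((teich p + teich q).coeff i.succPNat)) * f =
      verschiebung i.succPNat (teich ((teich p + teich q).coeff i.succPNat * t ^ i) * f) := fun i => by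
    rw [verschiebung_mul, hf, map_mul, map_pow, mul_assoc]
    simp
  rw [Finset.sum_mul, Finset.sum_congr rfl fun i _ => h i, evalOne_sum hN]
  · exact Finset.prod_congr rfl fun i _ => evalOne_verschiebung hN (hc i) f
  · exact fun i _ => isAdapted_verschiebung (by simpa using hc i) f

/-- The values `∏_n (1 - p^n f_n)`, for `f` in `ℍ^t`, multiply through a universal group law. -/
theorem exists_evalOne_mul_eq {K : ℕ} (hN : N ^ K = ⊥) (t : D) {j : ℕ} (hj : 0 < j) (hjK : j ≤ K) :
    ∀ p ∈ N, ∀ q ∈ N ^ j, ∃ z ∈ N, ∀ (E : Type u) [CommRing E] (ψ : D →+* E) (f : BigWitt E),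
      (∀ n : ℕ+, frob n f = teich (ψ t) ^ ((n : ℕ) - 1) * f) →
      evalOne K (teich (ψ p) * f) * evalOne K (teich (ψ q) * f) = evalOne K (teich (ψ z) * f) := by
  induction hjK using Nat.decreasingInduction with
  -- Downward induction on the order `j` of `q`. At j = K, q = 0 and its factor is 1.
  | self =>
    intro p hp q hq
    have hq0 : q = 0 := by rwa [hN, Ideal.mem_bot] at hq
    subst hq0
    refine ⟨p, hp, fun E _ ψ f _ => ?_⟩
    rw [map_zero, teich_zero, zero_mul]
    simp [evalOne, coeff_zero]
  | of_succ j hjK ih =>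
    have ih := ih j.succ_pos
    -- Arguments of order j + 1 can be absorbed one at a time into the leading factor. The witness
    -- is chosen before `E`, `ψ` and `f`, so it stays independent of them.
    have key : ∀ (s : Finset ℕ) (c : ℕ → D), (∀ i ∈ s, c i ∈ N ^ (j + 1)) → ∀ p ∈ N, ∃ z ∈ N,
        ∀ (E : Type u) [CommRing E] (ψ : D →+* E) (f : BigWitt E),
        (∀ n : ℕ+, frob n f = teich (ψ t) ^ ((n : ℕ) - 1) * f) →
        evalOne K (teich (ψ p) * f) * ∏ i ∈ s, evalOne K (teich (ψ (c i)) * f) =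
          evalOne K (teich (ψ z) * f) := by
      intro s c
      induction s using Finset.induction_on with
      | empty => exact fun _ p hp => ⟨p, hp, fun E _ ψ f _ => by rw [Finset.prod_empty, mul_one]⟩
      | insert a s ha ihs =>
        intro hc p hp
        obtain ⟨z, hz, h⟩ := ih p hp (c a) (hc a (Finset.mem_insert_self _ _))
        obtain ⟨z', hz', h'⟩ := ihs (fun i hi => hc i (Finset.mem_insert_of_mem hi)) z hz
        refine ⟨z', hz', fun E _ ψ f hf => ?_⟩
        rw [Finset.prod_insert ha, ← mul_assoc, h E ψ f hf, h' E ψ f hf]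
    intro p hp q hq
    have hqN : q ∈ N := by
      simpa using Ideal.pow_le_pow_right hj hq
    have hpq : p * q ∈ N ^ (j + 1) := by
      rw [pow_succ']; exact Ideal.mul_mem_mul hp hq
    -- Index 0 is the first Witt coordinate p + q of [p] + [q]. All other coordinates are divisible
    -- by pq and so have order at least j + 1.
    obtain ⟨z, hz, h⟩ := key ((Finset.range K).erase 0)
      (fun i => (teich p + teich q).coeff i.succPNat * t ^ i) (fun i hi => by
        refine Ideal.mul_mem_right _ _ (coeff_teich_add_mem hpq _ fun h => ?_)
        exact Finset.ne_of_mem_erase hi (Nat.succPNat_injective h)) (p + q) (add_mem hp hqN)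
    refine ⟨z, hz, fun E _ ψ f hf => ?_⟩
    have hNE : (N.map ψ) ^ K = ⊥ := by rw [← Ideal.map_pow, hN, Ideal.map_bot]
    rw [← h E ψ f hf, evalOne_teich_mul_mul hNE (ψ t) hf (Ideal.mem_map_of_mem ψ hp)
      (Ideal.mem_map_of_mem ψ hqN), ← Finset.mul_prod_erase _ _ (Finset.mem_range.mpr
      (lt_of_lt_of_le hj hjK.le))]
    have h1 : (teich (ψ p) + teich (ψ q)).coeff (Nat.succPNat 0) * ψ t ^ 0 = ψ (p + q) := by
      rw [pow_zero, mul_one, map_add]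
      exact coeff_one_add _ _
    rw [h1]
    refine congrArg _ (Finset.prod_congr rfl fun i _ => ?_)
    rw [map_mul ψ, map_pow ψ, ← map_coeff, map_add, map_teich, map_teich]

end Evaluation

/-! ### The group law p + q - tpq and the product rule for coefficients -/

section StructureConstants

/-- The coefficient of `x^i y^j` in `(x + y - t x y)^k`. -/
noncomputable def structConst {B : Type u} [CommRing B] (t : B) (i j k : ℕ) : B :=
  MvPolynomial.coeff (Finsupp.single 0 i + Finsupp.single 1 j)
    ((MvPolynomial.X 0 + MvPolynomial.X 1 - MvPolynomial.C t * MvPolynomial.X 0 * MvPolynomial.X 1 :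
      MvPolynomial (Fin 2) B) ^ k)

theorem map_structConst {A : Type u} {B : Type v} [CommRing A] [CommRing B] (φ : A →+* B) (t : A)
    (i j k : ℕ) : φ (structConst t i j k) = structConst (φ t) i j k := by
  rw [structConst, ← MvPolynomial.coeff_map]
  simp [structConst]

variable {B : Type u} [CommRing B]

theorem map_mk_pow_eq_bot {R : Type*} [CommRing R] (I : Ideal R) (K : ℕ) :
    I.map (Ideal.Quotient.mk (I ^ K)) ^ K = ⊥ := by
  rw [← Ideal.map_pow, Ideal.map_quotient_self]

-- Membership in a power of the ideal of variables means that the coefficients of low total degree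
-- vanish, and X is not a zero divisor in B[X]. This is what permits cancelling a generic parameter.
open MvPolynomial in
theorem mem_idealOfVars_pow_of_C_X_mul {σ : Type*} {K : ℕ} {m : MvPolynomial σ B[X]}
    (h : MvPolynomial.C (Polynomial.X : B[X]) * m ∈ idealOfVars σ B[X] ^ K) :
    m ∈ idealOfVars σ B[X] ^ K := by
  rw [mem_pow_idealOfVars_iff'] at h ⊢
  intro x hx
  have := h x hx
  rw [MvPolynomial.coeff_C_mul] at this
  ext n
  simpa using congrArg (fun p => Polynomial.coeff p (n + 1)) this

theorem evalOne_teich {K : ℕ} (hK : 0 < K) (c : B) : evalOne K (teich c) = 1 - c := by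
  rw [evalOne, Finset.prod_eq_single 0]
  · rfl
  · intro i _ hi
    rw [coeff_teich, if_neg, sub_zero]
    exact fun h => hi (Nat.succPNat_injective h)
  · exact fun h => absurd (Finset.mem_range.mpr hK) h

-- This is F(p)F(q) = F(p + q - tpq) modulo terms of degree `K`, with p and q the two variables. The
-- universal law first provides some F(z); working with a polynomial variable in place of `t` makes
-- z identifiable, and the parameter is specialised to `t` afterwards.
open MvPolynomial in
theorem sum_series_mul_sum_series_sub_mem (t : B) {f : BigWitt B}
    (hf : ∀ n : ℕ+, frob n f = teich t ^ ((n : ℕ) - 1) * f) {K : ℕ} (hK : 0 < K) :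
    (∑ i ∈ Finset.range K, MvPolynomial.C (PowerSeries.coeff i (series f)) * MvPolynomial.X 0 ^ i) *
      (∑ i ∈ Finset.range K, MvPolynomial.C (PowerSeries.coeff i (series f)) * MvPolynomial.X 1 ^ i) -
      ∑ i ∈ Finset.range K, MvPolynomial.C (PowerSeries.coeff i (series f)) *
        (MvPolynomial.X 0 + MvPolynomial.X 1 -
          MvPolynomial.C t * MvPolynomial.X 0 * MvPolynomial.X 1) ^ i ∈
      idealOfVars (Fin 2) B ^ K := by
  set I := idealOfVars (Fin 2) B[X] with hI
  set J := idealOfVars (Fin 2) B with hJ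
  let π := Ideal.Quotient.mk (I ^ K)
  let ρ := Ideal.Quotient.mk (J ^ K)
  let ev : MvPolynomial (Fin 2) B[X] →+* MvPolynomial (Fin 2) B :=
    MvPolynomial.map (Polynomial.evalRingHom t)
  have hev : I ^ K ≤ (J ^ K).comap ev := by
    rw [← Ideal.map_le_iff_le_comap, Ideal.map_pow]
    refine Ideal.pow_right_mono ?_ K
    rw [Ideal.map_le_iff_le_comap, hI, idealOfVars, Ideal.span_le]
    rintro _ ⟨i, rfl⟩
    simp only [SetLike.mem_coe, Ideal.mem_comap, ev, MvPolynomial.map_X]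
    exact Ideal.subset_span ⟨i, rfl⟩
  let ψ := Ideal.quotientMap (J ^ K) ev hev
  have hψ : ∀ m, ψ (π m) = ρ (ev m) := fun m => Ideal.quotientMap_mk
  have hN : (I.map π) ^ K = ⊥ := map_mk_pow_eq_bot I K
  have hX : ∀ i : Fin 2, (MvPolynomial.X i : MvPolynomial (Fin 2) B[X]) ∈ I := fun i =>
    Ideal.subset_span ⟨i, rfl⟩
  let τ := π (MvPolynomial.C Polynomial.X)
  obtain ⟨z, hz, h⟩ := exists_evalOne_mul_eq hN τ one_pos hK
    (π (MvPolynomial.X 0)) (Ideal.mem_map_of_mem π (hX 0)) (π (MvPolynomial.X 1))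
    (by rw [pow_one]; exact Ideal.mem_map_of_mem π (hX 1))
  -- Test the law on f = [τ], where F(c) = 1 - cτ. It gives (1 - pτ)(1 - qτ) = 1 - zτ, that is τz =
  -- τ(p + q - τpq), and τ cancels.
  have hz1 : z = π (MvPolynomial.X 0 + MvPolynomial.X 1 -
      MvPolynomial.C Polynomial.X * MvPolynomial.X 0 * MvPolynomial.X 1) := by
    have h1 := h _ (RingHom.id _) (teich τ) (fun n => by
      rw [frob_teich, RingHom.id_apply, ← pow_succ, Nat.sub_add_cancel n.pos])
    simp only [RingHom.id_apply, ← map_mul, evalOne_teich hK] at h1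
    obtain ⟨ζ, rfl⟩ := Ideal.Quotient.mk_surjective z
    rw [Ideal.Quotient.eq]
    refine mem_idealOfVars_pow_of_C_X_mul ?_
    rw [← Ideal.Quotient.eq_zero_iff_mem]
    simp only [map_mul, map_sub, map_add] at h1 ⊢
    linear_combination h1
  have hNJ : (J.map ρ) ^ K = ⊥ := map_mk_pow_eq_bot J K
  have hXJ : ∀ i : Fin 2, ρ (MvPolynomial.X i : MvPolynomial (Fin 2) B) ∈ J.map ρ := fun i =>
    Ideal.mem_map_of_mem ρ (Ideal.subset_span ⟨i, rfl⟩)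
  let κ := ρ.comp MvPolynomial.C
  have hτ : ψ τ = κ t := by simp [τ, hψ, ev, κ]
  have h2 := h _ ψ (map κ f) (fun n => by
    rw [← map_frob, hf, map_mul, map_pow, map_teich, hτ])
  have hz2 : ψ z = ρ (MvPolynomial.X 0 + MvPolynomial.X 1 -
      MvPolynomial.C t * MvPolynomial.X 0 * MvPolynomial.X 1) := by
    rw [hz1, hψ]; simp [ev]
  have hzJ : ψ z ∈ J.map ρ := by
    rw [hz2, map_sub, map_add, map_mul]
    exact sub_mem (add_mem (hXJ 0) (hXJ 1)) (Ideal.mul_mem_left _ _ (hXJ 1))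
  rw [evalOne_teich_mul_eq_sum hNJ hzJ, hψ, hψ] at h2
  simp only [ev, MvPolynomial.map_X] at h2
  rw [evalOne_teich_mul_eq_sum hNJ (hXJ 0), evalOne_teich_mul_eq_sum hNJ (hXJ 1), hz2] at h2
  rw [← Ideal.Quotient.eq]
  simp only [← map_series, PowerSeries.coeff_map] at h2
  rw [map_mul, map_sum, map_sum, map_sum]
  simp only [map_mul, map_pow]
  exact h2

theorem coeff_series_mul_coeff_series (t : B) {f : BigWitt B}
    (hf : ∀ n : ℕ+, frob n f = teich t ^ ((n : ℕ) - 1) * f) (i j : ℕ) :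
    PowerSeries.coeff i (series f) * PowerSeries.coeff j (series f) =
      ∑ k ∈ Finset.range (i + j + 1), PowerSeries.coeff k (series f) * structConst t i j k := by
  -- The monomial x^i y^j has degree i + j, so precision i + j + 1 is just enough to see its
  -- coefficient.
  have h := sum_series_mul_sum_series_sub_mem t hf (i + j).succ_pos
  rw [MvPolynomial.mem_pow_idealOfVars_iff'] at h
  have h1 := h (Finsupp.single 0 i + Finsupp.single 1 j) (by
    simp [map_add, Finsupp.degree_single])
  rw [MvPolynomial.coeff_sub, sub_eq_zero] at h1
  simp only [MvPolynomial.coeff_sum, MvPolynomial.coeff_C_mul] at h1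
  rw [← Nat.succ_eq_add_one]
  refine Eq.trans ?_ h1
  have h2 : ∀ (a b : B) (k l : ℕ), MvPolynomial.C a * MvPolynomial.X (0 : Fin 2) ^ k *
      (MvPolynomial.C b * MvPolynomial.X 1 ^ l) =
      MvPolynomial.monomial (Finsupp.single 0 k + Finsupp.single 1 l) (a * b) := fun a b k l => by
    rw [MvPolynomial.C_mul_X_pow_eq_monomial, MvPolynomial.C_mul_X_pow_eq_monomial, MvPolynomial.monomial_mul]
  have h3 : ∀ k l : ℕ, (Finsupp.single 0 k + Finsupp.single 1 l : Fin 2 →₀ ℕ) =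
      Finsupp.single 0 i + Finsupp.single 1 j ↔ k = i ∧ l = j := fun k l => by
    refine ⟨fun h => ⟨?_, ?_⟩, fun h => by rw [h.1, h.2]⟩
    · simpa using DFunLike.congr_fun h 0
    · simpa using DFunLike.congr_fun h 1
  rw [Finset.sum_mul_sum]
  simp only [h2, MvPolynomial.coeff_sum, MvPolynomial.coeff_monomial, h3, ite_and]
  rw [Finset.sum_eq_single i (fun k _ hk => by simp [hk]) (fun h => absurd (Finset.mem_range.mpr
    (by omega)) h), Finset.sum_eq_single j (fun k _ hk => by simp [hk]) (fun h => absurd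
    (Finset.mem_range.mpr (by omega)) h), if_pos rfl, if_pos rfl]

end StructureConstants

end BigWitt

/-! ### The universal point and the map from algebra homomorphisms to Witt vectors -/

theorem BigWitt.series_nsmul {A : Type u} [CommRing A] (k : ℕ) (y : BigWitt A) :
    BigWitt.series (k • y) = BigWitt.series y ^ k := by
  induction k with
  | zero => rw [zero_nsmul, BigWitt.series_zero, pow_zero]
  | succ k ih => rw [succ_nsmul, BigWitt.series_add, ih, pow_succ]

theorem PowerSeries.coeff_one_sub_C_mul_X_pow {A : Type u} [CommRing A] (c : A) (k n : ℕ) :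
    PowerSeries.coeff n ((1 - PowerSeries.C c * PowerSeries.X) ^ k) =
      (-1) ^ n * ((k.choose n : ℕ) * c ^ n) := by
  have h : (1 - PowerSeries.C c * PowerSeries.X : PowerSeries A) ^ k =
      PowerSeries.rescale (-c) (((1 + Polynomial.X : A[X]) ^ k : A[X]) : PowerSeries A) := by
    simp [PowerSeries.rescale_X, sub_eq_add_neg]
  rw [h, PowerSeries.coeff_rescale, Polynomial.coeff_coe, Polynomial.coeff_one_add_X_pow, neg_pow]
  ring

namespace ReesIntZ

/-- The matrix binom(k, i) is triangular with ones on the diagonal, so natural numbers suffice. This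
matters because the universal point is a multiple k·[t] only for k ≥ 0 in the form used below. -/
theorem ext_nat (z w : ReesIntZ) (h : ∀ k : ℕ, ev k z = ev k w) : z = w := by
  rw [← sub_eq_zero]
  refine eq_zero_of_triangular basis (fun k : ℕ => (ev k).toLinearMap) ?_ ?_ _ ?_
  · intro i k hik
    simp [ev_b, choose_of_lt hik]
  · intro i s hs
    rw [AlgHom.toLinearMap_apply, basis_apply, ev_b, choose_self] at hs
    exact smul_eq_zero_of _ _ _ one_ne_zero hs
  · intro k
    simp [h]

theorem b_zero : b 0 = 1 := ext₁ _ _ fun k => by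
  rw [ev_b, map_one, Ring.choose_zero_right]; rfl

theorem ev_t (k : ℤ) : ev k IntZ.filDeg.t = LaurentPolynomial.T 1 := by
  rw [← RingFiltration.algebraMap_X, AlgHom.commutes, LaurentPolynomial.algebraMap_eq_toLaurent,
    Polynomial.toLaurent_X]

/-- The universal point of `ℍ^t`, the Witt vector of the series `(1 - t Z)^x`. -/
noncomputable def univ : BigWitt ReesIntZ :=
  BigWitt.ofSeries (PowerSeries.mk fun n => (-1) ^ n * b n)

theorem coeff_series_univ (n : ℕ) :
    PowerSeries.coeff n (BigWitt.series univ) = (-1) ^ n * b n := by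
  rw [univ, BigWitt.series_ofSeries, PowerSeries.coeff_mk]
  rw [PowerSeries.coeff_mk, pow_zero, one_mul, b_zero]

/-- By the binomial theorem (1 - TZ)^k has the specialised coefficients, and it is the k-th power of
the series of [T]. -/
theorem map_ev_univ (k : ℕ) : BigWitt.map (ev k).toRingHom univ =
    k • BigWitt.teich (LaurentPolynomial.T 1) := by
  apply BigWitt.series_injective
  ext1 n
  rw [BigWitt.series_nsmul, BigWitt.series_teich, ← BigWitt.map_series,
    PowerSeries.coeff_one_sub_C_mul_X_pow, PowerSeries.coeff_map, coeff_series_univ]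
  have h : (ev k).toRingHom (b n) = ((k.choose n : ℕ) : ℤ[T;T⁻¹]) * LaurentPolynomial.T 1 ^ n := by
    refine (ev_b k n).trans ?_
    rw [Ring.choose_natCast, LaurentPolynomial.single_eq_C_mul_T, LaurentPolynomial.T_pow, mul_one]
    simp
  rw [map_mul, h]
  simp

theorem frob_univ (n : ℕ+) :
    BigWitt.frob n univ = BigWitt.teich IntZ.filDeg.t ^ ((n : ℕ) - 1) * univ := by
  ext1; funext m
  -- Each Witt coordinate is compared after specialisation at x = k, where both sides become
  -- k·[T]^n.
  refine ext_nat _ _ fun k => ?_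
  have key : BigWitt.map (ev k).toRingHom (BigWitt.frob n univ) =
      BigWitt.map (ev k).toRingHom (BigWitt.teich IntZ.filDeg.t ^ ((n : ℕ) - 1) * univ) := by
    have ht : (ev k).toRingHom IntZ.filDeg.t = LaurentPolynomial.T 1 := ev_t k
    rw [BigWitt.map_frob, map_mul, map_pow, BigWitt.map_teich, map_ev_univ, ht, map_nsmul,
      BigWitt.frob_teich, mul_smul_comm, ← pow_succ, Nat.sub_add_cancel n.pos]
  exact congrArg (fun y => y.coeff m) key

variable {B : Type u} [CommRing B] [Algebra ℤ[X] B]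

/-- The point of `ℍ^t` attached to a point of the spectrum of the Rees algebra. -/
noncomputable def toWitt (φ : ReesIntZ →ₐ[ℤ[X]] B) : BigWitt B :=
  BigWitt.map φ.toRingHom univ

theorem coeff_series_toWitt (φ : ReesIntZ →ₐ[ℤ[X]] B) (n : ℕ) :
    PowerSeries.coeff n (BigWitt.series (toWitt φ)) = (-1) ^ n * φ (b n) := by
  rw [toWitt, ← BigWitt.map_series, PowerSeries.coeff_map, coeff_series_univ]
  simp

theorem apply_t (φ : ReesIntZ →ₐ[ℤ[X]] B) : φ IntZ.filDeg.t = algebraMap ℤ[X] B X := by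
  rw [← RingFiltration.algebraMap_X, AlgHom.commutes]

theorem frob_toWitt (φ : ReesIntZ →ₐ[ℤ[X]] B) (n : ℕ+) : BigWitt.frob n (toWitt φ) =
    BigWitt.teich (algebraMap ℤ[X] B X) ^ ((n : ℕ) - 1) * toWitt φ := by
  have ht : φ.toRingHom IntZ.filDeg.t = algebraMap ℤ[X] B X := apply_t φ
  rw [toWitt, ← BigWitt.map_frob, frob_univ, map_mul, map_pow, BigWitt.map_teich, ht]

/-- The coefficients of the series are, up to sign, the values on the basis. -/
theorem toWitt_injective : Function.Injective (toWitt : (ReesIntZ →ₐ[ℤ[X]] B) → BigWitt B) := by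
  intro φ ψ h
  refine AlgHom.toLinearMap_injective (basis.ext fun n => ?_)
  have h1 := congrArg (fun y => PowerSeries.coeff n (BigWitt.series y)) h
  simp only [coeff_series_toWitt] at h1
  rw [basis_apply]
  exact ((isUnit_one.neg.pow n).mul_right_injective h1)

/-- The comultiplication of `b n` runs over i + j = n exactly as the n-th coefficient of a product
of series does, and the sign (-1)^n is multiplicative in n. -/
theorem toWitt_mul (φ ψ : WithConv (ReesIntZ →ₐ[ℤ[X]] B)) :
    toWitt (φ * ψ).ofConv = toWitt φ.ofConv + toWitt ψ.ofConv := by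
  apply BigWitt.series_injective
  ext1 n
  rw [BigWitt.series_add, PowerSeries.coeff_mul, coeff_series_toWitt]
  have h : (φ * ψ).ofConv (b n) = _ := AlgHom.convMul_apply φ ψ (b n)
  rw [h, comul_b, map_sum, Finset.mul_sum]
  refine Finset.sum_congr rfl fun q hq => ?_
  rw [Algebra.TensorProduct.lift_tmul, coeff_series_toWitt, coeff_series_toWitt,
    ← Finset.HasAntidiagonal.mem_antidiagonal.mp hq, pow_add]
  ring

/-! ### The inverse: algebra homomorphisms from points of ℍ^t -/

/-- The linear map sending the basis `b` to the signed coefficients of the series of `f`. -/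
noncomputable def ofWittLin (f : BigWitt B) : ReesIntZ →ₗ[ℤ[X]] B :=
  basis.constr ℤ[X] fun n => (-1) ^ n * PowerSeries.coeff n (BigWitt.series f)

theorem ofWittLin_b (f : BigWitt B) (n : ℕ) :
    ofWittLin f (b n) = (-1) ^ n * PowerSeries.coeff n (BigWitt.series f) := by
  rw [← basis_apply, ofWittLin, Module.Basis.constr_basis]

theorem ofWittLin_neg_one_pow_mul (f : BigWitt B) (n : ℕ) (r : ReesIntZ) :
    ofWittLin f ((-1) ^ n * r) = (-1) ^ n * ofWittLin f r := by
  rcases neg_one_pow_eq_or ReesIntZ n with h | h <;>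
  rcases Nat.even_or_odd n with h' | h' <;> simp [h'.neg_one_pow]

/-- The product rule `coeff_series_mul_coeff_series` holds for `univ`, where it describes
multiplication of the basis, and for `f`, where it describes multiplication of the prescribed
values. The structure constants come from ℤ[t], so the linear map carries one identity to the other;
they never need to be computed. -/
theorem ofWittLin_b_mul_b {f : BigWitt B} (hf : ∀ n : ℕ+, BigWitt.frob n f =
    BigWitt.teich (algebraMap ℤ[X] B X) ^ ((n : ℕ) - 1) * f) (i j : ℕ) :
    ofWittLin f (b i * b j) = ofWittLin f (b i) * ofWittLin f (b j) := by
  have h1 := BigWitt.coeff_series_mul_coeff_series _ frob_univ i j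
  have h2 := BigWitt.coeff_series_mul_coeff_series _ hf i j
  simp only [coeff_series_univ] at h1
  have h3 := congrArg (ofWittLin f) h1
  rw [map_sum] at h3
  have h4 : ∀ k, ofWittLin f ((-1) ^ k * b k * BigWitt.structConst IntZ.filDeg.t i j k) =
      PowerSeries.coeff k (BigWitt.series f) *
        BigWitt.structConst (algebraMap ℤ[X] B X) i j k := fun k => by
    rw [← RingFiltration.algebraMap_X, ← BigWitt.map_structConst, ← BigWitt.map_structConst,
      mul_comm, ← Algebra.smul_def, map_smul, ofWittLin_neg_one_pow_mul, ofWittLin_b,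
      ← mul_assoc, ← mul_pow, Algebra.smul_def, mul_comm]
    simp
  simp only [h4] at h3
  rw [← h2, mul_mul_mul_comm, ← pow_add, ofWittLin_neg_one_pow_mul] at h3
  rw [ofWittLin_b, ofWittLin_b, mul_mul_mul_comm, ← h3, ← mul_assoc, ← pow_add, ← pow_add,
    Even.neg_one_pow ⟨_, rfl⟩, one_mul]

/-- The point of the spectrum of the Rees algebra attached to a point of `ℍ^t`. -/
noncomputable def ofWitt (f : BigWitt B) (hf : ∀ n : ℕ+, BigWitt.frob n f =
    BigWitt.teich (algebraMap ℤ[X] B X) ^ ((n : ℕ) - 1) * f) : ReesIntZ →ₐ[ℤ[X]] B :=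
  AlgHom.ofLinearMap (ofWittLin f)
    (by rw [← b_zero, ofWittLin_b, pow_zero, one_mul, BigWitt.coeff_zero_series])
    (by
      rw [LinearMap.map_mul_iff]
      refine basis.ext fun i => basis.ext fun j => ?_
      simpa using ofWittLin_b_mul_b hf i j)

theorem toWitt_ofWitt (f : BigWitt B) (hf : ∀ n : ℕ+, BigWitt.frob n f =
    BigWitt.teich (algebraMap ℤ[X] B X) ^ ((n : ℕ) - 1) * f) : toWitt (ofWitt f hf) = f := by
  apply BigWitt.series_injective
  ext1 n
  rw [coeff_series_toWitt]
  have : ofWitt f hf (b n) = _ := ofWittLin_b f n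
  rw [this, ← mul_assoc, ← pow_add, Even.neg_one_pow ⟨_, rfl⟩, one_mul]

end ReesIntZ

/-! ### Equivariance as a weight condition on coefficients -/

theorem GmTorsor.act_apply_of_mem_weight {A : Type u} [CommRing A] (P : GmTorsor A) {n : ℕ}
    {y : P.ring} (hy : y ∈ P.weight n) {R : Type u} [CommRing R] (u : Rˣ) (χ : P.ring →+* R) :
    P.act u χ y = (u : R) ^ n * χ y := by
  have h : P.act u χ y = LaurentPolynomial.eval₂ χ u (P.coact y) := rfl
  rw [h, P.mem_weight.mp hy, LaurentPolynomial.eval₂_C_mul_T, mul_comm]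
  simp

/-- Both operations multiply the n-th coefficient of the series by u^n: the action because that
coefficient has weight n, and [u] because it rescales Z. -/
theorem GmTorsor.map_act_eq_of_coeff_mem_weight {A : Type u} [CommRing A] (P : GmTorsor A)
    {f : BigWitt P.ring} (hf : ∀ n : ℕ, PowerSeries.coeff n (BigWitt.series f) ∈ P.weight n)
    {R : Type u} [CommRing R] (u : Rˣ) (χ : P.ring →+* R) :
    BigWitt.map (P.act u χ) f = BigWitt.teich (u : R) * BigWitt.map χ f := by
  apply BigWitt.series_injective
  ext1 n
  rw [BigWitt.series_teich_mul, PowerSeries.coeff_rescale, ← BigWitt.map_series,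
    ← BigWitt.map_series, PowerSeries.coeff_map, PowerSeries.coeff_map,
    P.act_apply_of_mem_weight (hf n)]

/-- It suffices to test on the universal pair: the unit T and the inclusion of constants into
P.ring[T, T⁻¹], for which the translated point is the coaction itself. -/
theorem GmTorsor.coeff_mem_weight_of_map_act_eq {A : Type u} [CommRing A] (P : GmTorsor A)
    {f : BigWitt P.ring} (hf : ∀ (R : Type u) [CommRing R] (u : Rˣ) (χ : P.ring →+* R),
      BigWitt.map (P.act u χ) f = BigWitt.teich (u : R) * BigWitt.map χ f) (n : ℕ) :
    PowerSeries.coeff n (BigWitt.series f) ∈ P.weight n := by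
  let τ : (P.ring[T;T⁻¹])ˣ := (LaurentPolynomial.isUnit_T 1).unit
  have h := congrArg (fun y => PowerSeries.coeff n (BigWitt.series y))
    (hf P.ring[T;T⁻¹] τ LaurentPolynomial.C)
  have h3 : P.act τ LaurentPolynomial.C = P.coact.toRingHom := by
    rw [GmTorsor.act, coactPoint, eval₂_C_T, RingHom.id_comp]
  simp only [h3, BigWitt.series_teich_mul, PowerSeries.coeff_rescale, ← BigWitt.map_series,
    PowerSeries.coeff_map] at h
  rw [P.mem_weight, mul_comm]
  refine h.trans ?_
  rw [IsUnit.unit_spec, LaurentPolynomial.T_pow, mul_one]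

theorem HtPts.frob_eq {x : A1modGm.{u}} {f : BigWitt x.P.ring} (hf : f ∈ HtPts x) (n : ℕ+) :
    BigWitt.frob n f = BigWitt.teich (A := x.P.ring) x.pt ^ ((n : ℕ) - 1) * f :=
  sub_eq_zero.mp ((HtPts.lift hf).2 n)

theorem HtPts.coeff_mem_weight {x : A1modGm.{u}} {f : BigWitt x.P.ring} (hf : f ∈ HtPts x) (n : ℕ) :
    PowerSeries.coeff n (BigWitt.series f) ∈ x.P.weight n :=
  x.P.coeff_mem_weight_of_map_act_eq (fun R _ u χ =>
    congrArg (fun z => z.1.1) (HtPts.lift_isEquivariant hf R u χ)) n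

theorem HtPts.mem_of_coeff_mem_weight {x : A1modGm.{u}} {f : BigWitt x.P.ring}
    (hf : ∀ n : ℕ+, BigWitt.frob n f = BigWitt.teich (A := x.P.ring) x.pt ^ ((n : ℕ) - 1) * f)
    (h : ∀ n : ℕ, PowerSeries.coeff n (BigWitt.series f) ∈ x.P.weight n) : f ∈ HtPts x :=
  ⟨⟨(f, x.pt), fun n => sub_eq_zero.mpr (hf n)⟩, rfl, fun R _ u χ => Subtype.ext (Prod.ext
    (x.P.map_act_eq_of_coeff_mem_weight h u χ) (x.equivariant R u χ))⟩

theorem neg_one_pow_mul_mem {R : Type u} [Ring R] (S : AddSubgroup R) (n : ℕ) {a : R}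
    (ha : a ∈ S) : (-1) ^ n * a ∈ S := by
  rcases neg_one_pow_eq_or R n with h | h <;> simpa [h] using ha

theorem ReesIntZ.toWitt_mem_HtPts {x : A1modGm.{u}} {φ : ReesIntZ →ₐ[ℤ[X]] x.ring}
    (hφ : φ ∈ IntZ.filDeg.fSpec x) : ReesIntZ.toWitt (B := x.ring) φ ∈ HtPts x := by
  refine HtPts.mem_of_coeff_mem_weight (fun n => ?_) fun n => ?_
  · have h := ReesIntZ.frob_toWitt φ n
    rwa [A1modGm.algebraMap_X] at h
  · have h := ReesIntZ.coeff_series_toWitt φ n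
    have h2 := neg_one_pow_mul_mem (x.weight n) n ((ReesIntZ.mem_fSpec_iff x φ).mp hφ n)
    rw [← h] at h2
    exact h2

/-! ### The isomorphism over 𝔸¹/𝔾_m -/

/-- The homomorphism from the points of `ℍ_fil` to those of `ℍ^t/𝔾_m` over a point of `𝔸¹/𝔾_m`. -/
noncomputable def HfilPts.toHtPts (x : A1modGm.{u}) : Additive (HfilPts x) →+ HtPts x :=
  AddMonoidHom.mk' (fun φ => ⟨ReesIntZ.toWitt (B := x.ring) φ.toMul.1.ofConv, ReesIntZ.toWitt_mem_HtPts φ.toMul.2⟩)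
    fun φ ψ => Subtype.ext (ReesIntZ.toWitt_mul φ.toMul.1 ψ.toMul.1)

theorem HfilPts.toHtPts_bijective (x : A1modGm.{u}) :
    Function.Bijective (HfilPts.toHtPts x) := by
  constructor
  · intro φ ψ h
    exact Additive.toMul.injective (Subtype.ext (WithConv.ofConv_injective
      (ReesIntZ.toWitt_injective (congrArg Subtype.val h))))
  · rintro ⟨f, hf⟩
    -- The same vector, retyped over the synonym `x.ring`, which carries the ℤ[t]-algebra structure.
    let g : BigWitt x.ring := f
    have hg : ∀ n : ℕ+, BigWitt.frob n g =
        BigWitt.teich (algebraMap ℤ[X] x.ring X) ^ ((n : ℕ) - 1) * g := fun n => by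
      rw [A1modGm.algebraMap_X]
      exact HtPts.frob_eq hf n
    have hφ : ReesIntZ.ofWitt g hg ∈ IntZ.filDeg.fSpec x := by
      refine (ReesIntZ.mem_fSpec_iff x _).mpr fun n => ?_
      have h : ReesIntZ.ofWitt g hg (ReesIntZ.b n) = _ := ReesIntZ.ofWittLin_b g n
      rw [h]
      -- Equivariance of `f` gives the weight of its coefficients, hence of the values on `b n`, and
      -- the grading only has to be checked there.
      exact neg_one_pow_mul_mem (x.weight n) n (HtPts.coeff_mem_weight hf n)
    exact ⟨Additive.ofMul ⟨toConv (ReesIntZ.ofWitt g hg), hφ⟩,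
      Subtype.ext (ReesIntZ.toWitt_ofWitt g hg)⟩

/-- The filtered Hilbert additive group `ℍ_fil = fSpec (fil_deg Int(ℤ))` and `ℍ^t / 𝔾_m` are isomorphic
as commutative groups over the stack `𝔸¹ / 𝔾_m`. -/
theorem mainTheorem11 : Nonempty (Hfil.{u} ≅ HtmodGm.{u}) := by
  refine ⟨NatIso.ofComponents (fun x =>
    (AddEquiv.ofBijective (HfilPts.toHtPts x) (HfilPts.toHtPts_bijective x)).toAddCommGrpIso) ?_⟩
  intro x y g
  ext φ
  -- Naturality: applying a ring map after φ, or to the Witt coordinates of φ(`univ`), is the same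
  -- computation coordinate by coordinate.
  rfl
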